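/- **Setting.** Let $d,r\ge 1$, let $u_1^\star,\dots,u_r^\star\in\mathbb R^d$ be nonzero and $T^\star=\sum_{l=1}^r u_l^\star\otimes u_l^\star\otimes u_l^\star\in\mathbb R^{d\times d\times d}$. Suppose that $$\max_{i,j,k}|T^\star_{i,j,k}|\le\sqrt{\mu_0/d^3}\,\|T^\star\|_F,\qquad \|u_l^\star\|_\infty\le\sqrt{\mu_1/d}\,\|u_l^\star\|_2\ (1\le l\le r),\qquad |\langle u_l^\star,u_m^\star\rangle|\le\sqrt{\mu_2/d}\,\|u_l^\star\|_2\|u_m^\star\|_2\ (l\ne m),$$ and put $\mu=\max\{\mu_0,\mu_1,\mu_2\}$ and $\kappa=\max_l\|u_l^\star\|_2^3/\min_l\|u_l^\star\|_2^3$. Let $\Omega\subseteq[d]^3$ be a random symmetric index set containing each $(i,j,k)$ with $i\le j\le k$ independently with probability $p\in(0,1]$. Independently of $\Omega$, let $E$ be a symmetric noise tensor whose entries $E_{i,j,k}$, $i\le j\le k$, are i.i.d. $\mathcal N(0,\sigma^2)$ with $\sigma>0$ (so $\sigma_{\min}=\sigma$). The data are $\mathcal P_\Omega(T^\star+E)$,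 that is, the entries of $T^\star+E$ in $\Omega$, with zeros outside $\Omega$. Given $\Omega$, an estimator (a function of the data, with values in a finite-dimensional space) of a quantity $\theta(U)$, where $U=[u_1,\dots,u_r]$, is called *locally unbiased at* $U^\star=[u^\star_1,\dots,u^\star_r]$ if its conditional mean $m(U)$, when the true factors are $U$, exists for all $U$ near $U^\star$ and satisfies $m(U)=\theta(U)+o(\|U-U^\star\|)$ as $U\to U^\star$. Every estimator that is unbiased for all $U$, or merely for all $U$ in a neighbourhood of $U^\star$, is locally unbiased at $U^\star$. For a number $\varepsilon$, let $\mathcal G_\varepsilon$ be the event (depending on $\Omega$ only) that, for every $1\le l\le r$, every estimator $\widehat u_l$ that is locally unbiased for $u_l$ at $U^\star$, and every estimator $\widehat T$ that is locally unbiased for $T=\sum_l u_l^{\otimes 3}$ at $U^\star$, $$\mathbb E\big[\|\widehat u_l-u_l^\star\|_2^2\,\big|\,\Omega\big]\ \ge\ \frac{(2-\varepsilon)\,\sigma_{\min}^2\,d}{p\,\|u_l^\star\|_2^4},\qquad \mathbb E\big[\|\widehat T-T^\star\|_F^2\,\big|\,\Omega\big]\ \ge\ \frac{(6-\varepsilon)\,\sigma_{\min}^2\,d\,r}{p}$$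 (the risks may be $+\infty$). **Theorem.** 1. (Bounded $r,\mu,\kappa$.) For all constants $R,M,K$ there are a constant $c_6>0$, a constant $C$ and a sequence $\varepsilon_d\to0$, depending only on $R,M,K$, such that whenever $r\le R$, $\mu\le M$, $\kappa\le K$ and $p\ge c_6\frac{\log^2 d}{d^2}$, one has $\mathbb P(\mathcal G_{\varepsilon_d})\ge 1-C d^{-10}$. 2. (General $r,\mu$.) For every constant $K$ there are constants $c_6,c_7>0$, a constant $C$ and a sequence $\varepsilon_d\to0$, depending only on $K$, such that whenever $\kappa\le K$, $p\ge c_6\frac{\mu^2 r\log^2 d}{d^2}$ and $r\le c_7\sqrt{\frac{d}{\mu\log d}}$, one has $\mathbb P(\mathcal G_{\varepsilon_d})\ge 1-C d^{-10}$. -/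

import Mathlib

open MeasureTheory ProbabilityTheory Filter Asymptotics
open scoped Topology ENNReal

namespace TensorCompletion

/-- Third-order tensors in `ℝ^{d × d × d}`. -/
abbrev Tensor (d : ℕ) : Type := Fin d → Fin d → Fin d → ℝ

/-- A list of `r` tensor factors `u_1, …, u_r` in `ℝ^d`, each with the Euclidean norm. -/
abbrev Factors (d r : ℕ) : Type := Fin r → EuclideanSpace ℝ (Fin d)

/-- Index triples `(i, j, k)` with `i ≤ j ≤ k`. -/
abbrev OrderedTriple (d : ℕ) : Type :=
  {t : Fin d × Fin d × Fin d // t.1 ≤ t.2.1 ∧ t.2.1 ≤ t.2.2}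

/-- The nondecreasing rearrangement of an index triple. -/
def sortTriple {d : ℕ} (i j k : Fin d) : OrderedTriple d :=
  ⟨(min i (min j k), max (min i j) (min (max i j) k), max i (max j k)), by
    constructor <;> grind⟩

/-- The CP tensor `∑_l u_l ⊗ u_l ⊗ u_l`. -/
noncomputable def cpTensor {d r : ℕ} (U : Factors d r) : Tensor d :=
  fun i j k => ∑ l, U l i * U l j * U l k

/-- The squared Frobenius norm of a tensor. -/
noncomputable def frobSq {d : ℕ} (T : Tensor d) : ℝ := ∑ i, ∑ j, ∑ k, T i j k ^ 2

/-- The Frobenius norm of a tensor. -/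
noncomputable def frob {d : ℕ} (T : Tensor d) : ℝ := √(frobSq T)

/-! ### Assumptions on the ground truth -/

/-- `λ_max = max_l ‖u_l‖₂³`. -/
noncomputable def lamMax {d r : ℕ} (U : Factors d r) : ℝ := ⨆ l, ‖U l‖ ^ 3

/-- `λ_min = min_l ‖u_l‖₂³`. -/
noncomputable def lamMin {d r : ℕ} (U : Factors d r) : ℝ := ⨅ l, ‖U l‖ ^ 3

/-- The condition number `κ = λ_max / λ_min`. -/
noncomputable def condNumber {d r : ℕ} (U : Factors d r) : ℝ := lamMax U / lamMin U

/-- The incoherence conditions with parameters `μ₀`, `μ₁`, `μ₂`. -/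
structure Incoherent {d r : ℕ} (U : Factors d r) (μ₀ μ₁ μ₂ : ℝ) : Prop where
  tensor : ∀ i j k, |cpTensor U i j k| ≤ √(μ₀ / (d : ℝ) ^ 3) * frob (cpTensor U)
  factor : ∀ l i, |U l i| ≤ √(μ₁ / (d : ℝ)) * ‖U l‖
  inner : ∀ l m, l ≠ m → |inner ℝ (U l) (U m)| ≤ √(μ₂ / (d : ℝ)) * ‖U l‖ * ‖U m‖

/-! ### Random sampling and random noise -/

/-- The law of the sampled ordered triples: every `(i, j, k)` with `i ≤ j ≤ k` is selected
independently with probability `p`. -/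
noncomputable def samplingLaw (d : ℕ) (p : unitInterval) : Measure (Set (OrderedTriple d)) :=
  setBernoulli Set.univ p

/-- The symmetric index set `Ω` generated by a set of ordered triples. -/
def symmSet {d : ℕ} (ω : Set (OrderedTriple d)) : Set (Fin d × Fin d × Fin d) :=
  {t | sortTriple t.1 t.2.1 t.2.2 ∈ ω}

/-- The law of the noise components `E_{i,j,k}`, `i ≤ j ≤ k`: i.i.d. `N(0, σ²)`. -/
noncomputable def noiseLaw (d : ℕ) (σ : ℝ) : Measure (OrderedTriple d → ℝ) :=
  Measure.pi fun _ => gaussianReal 0 (σ ^ 2).toNNReal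

/-- The symmetric noise tensor with the given components at the ordered triples. -/
def noiseTensor {d : ℕ} (e : OrderedTriple d → ℝ) : Tensor d :=
  fun i j k => e (sortTriple i j k)

open Classical in
/-- `P_Ω(T)`: the tensor that agrees with `T` on `Ω` and vanishes outside `Ω`. -/
noncomputable def projOn {d : ℕ} (Ω : Set (Fin d × Fin d × Fin d)) (T : Tensor d) : Tensor d :=
  fun i j k => if (i, j, k) ∈ Ω then T i j k else 0

/-- The law, for a fixed index set `Ω`, of the data `P_Ω(T + E)` when `T` is the CP tensor
of `U` and the noise has standard deviation `σ`. -/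
noncomputable def dataLaw {d r : ℕ} (Ω : Set (Fin d × Fin d × Fin d)) (σ : ℝ) (U : Factors d r) :
    Measure (Tensor d) :=
  (noiseLaw d σ).map fun e => projOn Ω (cpTensor U + noiseTensor e)

/-! ### Estimators -/

section Estimators

variable {d r : ℕ} {F : Type*} [NormedAddCommGroup F] [NormedSpace ℝ F]

/-- The estimator `est` (a function of the data for the index set `Ω`) is unbiased for the
quantity `target` at every parameter in the set `S`. -/
def UnbiasedOn (Ω : Set (Fin d × Fin d × Fin d)) (σ : ℝ) (S : Set (Factors d r))
    (target : Factors d r → F) (est : Tensor d → F) : Prop :=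
  ∀ U ∈ S, Integrable est (dataLaw Ω σ U) ∧ ∫ y, est y ∂(dataLaw Ω σ U) = target U

/-- The estimator `est` is locally unbiased for `target` at the parameter `U₀`: its mean exists
near `U₀` and agrees with `target` to first order at `U₀`
(in particular it equals `target U₀` at `U₀`). -/
def LocallyUnbiasedAt (Ω : Set (Fin d × Fin d × Fin d)) (σ : ℝ) (U₀ : Factors d r)
    (target : Factors d r → F) (est : Tensor d → F) : Prop :=
  (∀ᶠ U in 𝓝 U₀, Integrable est (dataLaw Ω σ U)) ∧
    (fun U => (∫ y, est y ∂(dataLaw Ω σ U)) - target U) =o[𝓝 U₀] fun U => U - U₀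

/-- Estimators that are unbiased on the whole parameter space, or only on some neighbourhood
of `U₀`, are locally unbiased at `U₀`. -/
theorem UnbiasedOn.locallyUnbiasedAt {Ω : Set (Fin d × Fin d × Fin d)} {σ : ℝ}
    {S : Set (Factors d r)} {U₀ : Factors d r} {target : Factors d r → F} {est : Tensor d → F}
    (h : UnbiasedOn Ω σ S target est) (hS : S ∈ 𝓝 U₀) :
    LocallyUnbiasedAt Ω σ U₀ target est := by
  refine ⟨?_, ?_⟩
  · filter_upwards [hS] with U hU using (h U hU).1
  · refine (isLittleO_zero _ _).congr' ?_ EventuallyEq.rfl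
    filter_upwards [hS] with U hU
    simp [(h U hU).2]

end Estimators

/-- The two lower bounds, with slack `ε` in the constants, for a given index set `Ω` and a given
ground truth `U`. The risks are expectations over the noise, as elements of `[0, ∞]`. -/
def RiskLowerBounds {d r : ℕ} (Ω : Set (Fin d × Fin d × Fin d)) (U : Factors d r)
    (p σ ε : ℝ) : Prop :=
  (∀ (l : Fin r) (uhat : Tensor d → EuclideanSpace ℝ (Fin d)),
    LocallyUnbiasedAt Ω σ U (fun V => V l) uhat →
      ENNReal.ofReal ((2 - ε) * σ ^ 2 * d / (p * ‖U l‖ ^ 4)) ≤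
        ∫⁻ y, ENNReal.ofReal (‖uhat y - U l‖ ^ 2) ∂(dataLaw Ω σ U)) ∧
  (∀ That : Tensor d → Tensor d,
    LocallyUnbiasedAt Ω σ U cpTensor That →
      ENNReal.ofReal ((6 - ε) * σ ^ 2 * d * r / p) ≤
        ∫⁻ y, ENNReal.ofReal (frobSq (That y - cpTensor U)) ∂(dataLaw Ω σ U))

end TensorCompletion

/-! The two bounds are trace forms of the Cramér–Rao inequality that never invert the Fisher
information. Given $\Omega$, the data are a Gaussian shift model, and a direction $H$ carries
information $\sigma^{-2}\sum_{t\in\omega}(\partial_H T)_t^2$, summed over the sampled ordered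
triples. Testing an estimator with functionals $\varphi_k$ along directions $H_k$ bounds its risk
below by $2c\sum_k D_k-c^2\sum_k I(H_k)$ for every real $c$, where $D_k$ is the derivative of
$\varphi_k(\text{target})$ along $H_k$ (`LocallyUnbiasedAt.risk_ge`). Only an upper bound on the
total information is then needed, so a singular Fisher matrix does no harm. Estimators have few
moments and no smoothness, so the inequality is obtained as the limit of Chapman–Robbins
inequalities for finite shifts (`chapmanRobbins_gaussianPi`).

For one factor the directions are the coordinate vectors in slot $l$: $\sum_k D_k=d$, and the
information concentrates near $\|u_l\|^4pd/(2\sigma^2)$. For the tensor there is one direction per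
entry $\tau$, chosen so that the derivative of $T$ is $Qe_\tau$ with $Q=\frac13\sum_l J_lJ_l^\top$
and $J_lh$ the symmetrization of $h\otimes x_l\otimes x_l$, where $x_l=u_l/\|u_l\|$. Since $J_l^\top
J_l=3I+6x_lx_l^\top$ and the $x_l$ are nearly orthogonal, $Q$ is close to the tangent projection up
to rank-one terms: its trace is $r(d+2)$ and its squared Frobenius norm is about $rd$. An ordered
triple stands for six entries, so the information is about $prd/(6\sigma^2)$. Optimizing $c$ gives
the constants 2 and 6.

The information is a weighted sum of independent Bernoulli variables. Incoherence bounds the weights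
by multiples of $(\mu/d)^2$ and $r(\mu/d)^2$, and a Chernoff bound with relative error $1/\log d$
(`setBernoulli_real_selectedWeight_ge_le`) fails with probability exponentially small in $d$
(`Incoherent.le_samplingLaw_riskLowerBounds`). -/

namespace TensorCompletion

/-! ### Gaussian shifts, likelihood ratios and the Chapman–Robbins inequality. -/

section GaussianShift

variable {ι : Type*} [Fintype ι]

/-- The density of `N(a, v)` with respect to `N(0, v)`. -/
noncomputable def gaussianShiftDensity (v a x : ℝ) : ℝ := Real.exp ((a * x - a ^ 2 / 2) / v)

/-- The likelihood ratio of the centred Gaussian product law shifted by `a`. -/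
noncomputable def gaussianLikelihood (v : ℝ) (a x : ι → ℝ) : ℝ :=
  ∏ i, gaussianShiftDensity v (a i) (x i)

theorem gaussianLikelihood_nonneg (v : ℝ) (a x : ι → ℝ) : 0 ≤ gaussianLikelihood v a x :=
  Finset.prod_nonneg fun _ _ => (Real.exp_pos _).le

theorem measurable_gaussianShiftDensity (v a : ℝ) : Measurable (gaussianShiftDensity v a) := by
  unfold gaussianShiftDensity
  fun_prop

theorem measurable_gaussianLikelihood (v : ℝ) (a : ι → ℝ) :
    Measurable (gaussianLikelihood v a) := by
  unfold gaussianLikelihood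
  exact Finset.measurable_fun_prod _ fun i _ =>
    (measurable_gaussianShiftDensity v (a i)).comp (measurable_pi_apply i)

theorem gaussianReal_eq_withDensity {v : NNReal} (hv : v ≠ 0) (a : ℝ) :
    gaussianReal a v =
      (gaussianReal 0 v).withDensity fun x => ENNReal.ofReal (gaussianShiftDensity v a x) := by
  have hv' : (v : ℝ) ≠ 0 := by exact_mod_cast hv
  rw [gaussianReal_of_var_ne_zero _ hv, gaussianReal_of_var_ne_zero _ hv,
    ← withDensity_mul _ (measurable_gaussianPDF _ _)
      (measurable_gaussianShiftDensity _ _).ennreal_ofReal]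
  congr 1
  ext x
  simp only [Pi.mul_apply, gaussianPDF]
  rw [← ENNReal.ofReal_mul (gaussianPDFReal_nonneg _ _ _)]
  congr 1
  rw [gaussianPDFReal, gaussianPDFReal, gaussianShiftDensity, mul_assoc _ (Real.exp _) (Real.exp _),
    ← Real.exp_add]
  congr 2
  field_simp
  ring

theorem integrable_gaussianShiftDensity (v : NNReal) (a : ℝ) :
    Integrable (gaussianShiftDensity v a) (gaussianReal 0 v) := by
  have : gaussianShiftDensity v a =
      fun x => Real.exp (a / v * x) * Real.exp (-(a ^ 2 / 2 / v)) := by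
    ext x
    rw [gaussianShiftDensity, ← Real.exp_add]
    congr 1
    ring
  rw [this]
  exact (integrable_exp_mul_gaussianReal _).mul_const _

theorem integral_exp_mul_gaussianReal (v : NNReal) (t : ℝ) :
    ∫ x, Real.exp (t * x) ∂(gaussianReal 0 v) = Real.exp (v * t ^ 2 / 2) := by
  have := congrFun (mgf_id_gaussianReal (μ := 0) (v := v)) t
  simpa [mgf] using this

theorem integrable_gaussianShiftDensity_sq (v : NNReal) (a : ℝ) :
    Integrable (fun x => gaussianShiftDensity v a x ^ 2) (gaussianReal 0 v) := by
  have : (fun x => gaussianShiftDensity v a x ^ 2) =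
      fun x => Real.exp (2 * a / v * x) * Real.exp (-(a ^ 2 / v)) := by
    ext x
    rw [gaussianShiftDensity, ← Real.exp_nat_mul, ← Real.exp_add]
    congr 1
    push_cast
    ring
  rw [this]
  exact (integrable_exp_mul_gaussianReal _).mul_const _

theorem integral_gaussianShiftDensity_sq {v : NNReal} (hv : v ≠ 0) (a : ℝ) :
    ∫ x, gaussianShiftDensity v a x ^ 2 ∂(gaussianReal 0 v) = Real.exp (a ^ 2 / v) := by
  have hv' : (v : ℝ) ≠ 0 := by exact_mod_cast hv
  have : (fun x => gaussianShiftDensity v a x ^ 2) =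
      fun x => Real.exp (2 * a / v * x) * Real.exp (-(a ^ 2 / v)) := by
    ext x
    rw [gaussianShiftDensity, ← Real.exp_nat_mul, ← Real.exp_add]
    congr 1
    push_cast
    ring
  rw [this, integral_mul_const, integral_exp_mul_gaussianReal, ← Real.exp_add]
  congr 1
  field_simp
  ring

/-- The centred Gaussian product law with variance `v`. -/
noncomputable abbrev gaussianPi (ι : Type*) [Fintype ι] (v : NNReal) : Measure (ι → ℝ) :=
  Measure.pi fun _ => gaussianReal 0 v

theorem integrable_gaussianLikelihood (v : NNReal) (a : ι → ℝ) :
    Integrable (gaussianLikelihood v a) (gaussianPi ι v) :=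
  Integrable.fintype_prod (f := fun i => gaussianShiftDensity v (a i))
    fun i => integrable_gaussianShiftDensity v (a i)

theorem pi_gaussianReal_eq_withDensity {v : NNReal} (hv : v ≠ 0) (a : ι → ℝ) :
    Measure.pi (fun i => gaussianReal (a i) v) =
      (gaussianPi ι v).withDensity fun x => ENNReal.ofReal (gaussianLikelihood v a x) := by
  refine Measure.pi_eq (μ := fun i => gaussianReal (a i) v) fun s hs => ?_
  have hind : ∀ i, Integrable ((s i).indicator (gaussianShiftDensity v (a i)))
      (gaussianReal 0 v) := fun i => (integrable_gaussianShiftDensity v (a i)).indicator (hs i)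
  have hnn : ∀ i x, 0 ≤ (s i).indicator (gaussianShiftDensity v (a i)) x := fun i x =>
    Set.indicator_nonneg (fun _ _ => (Real.exp_pos _).le) x
  have hpi : (Set.univ.pi s).indicator (fun x => ENNReal.ofReal (gaussianLikelihood v a x)) =
      fun x => ENNReal.ofReal (∏ i, (s i).indicator (gaussianShiftDensity v (a i)) (x i)) := by
    ext x
    by_cases hx : x ∈ Set.univ.pi s
    · rw [Set.indicator_of_mem hx, gaussianLikelihood]
      congr 1
      exact Finset.prod_congr rfl fun i _ => (Set.indicator_of_mem (hx i trivial) _).symm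
    · rw [Set.indicator_of_notMem hx]
      simp only [Set.mem_pi, Set.mem_univ, true_imp_iff, not_forall] at hx
      obtain ⟨i, hi⟩ := hx
      rw [Finset.prod_eq_zero (Finset.mem_univ i) (Set.indicator_of_notMem hi _)]
      simp
  rw [withDensity_apply _ (MeasurableSet.univ_pi hs),
    ← lintegral_indicator (MeasurableSet.univ_pi hs), hpi,
    ← ofReal_integral_eq_lintegral_ofReal (Integrable.fintype_prod (μ := fun _ : ι => gaussianReal 0 v) hind)
      (.of_forall fun x => Finset.prod_nonneg fun i _ => hnn i _),
    integral_fintype_prod_eq_prod, ENNReal.ofReal_prod_of_nonneg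
      fun i _ => integral_nonneg (hnn i)]
  refine Finset.prod_congr rfl fun i _ => ?_
  symm
  rw [gaussianReal_eq_withDensity hv (a i), withDensity_apply _ (hs i),
    ← lintegral_indicator (hs i),
    ofReal_integral_eq_lintegral_ofReal (hind i) (.of_forall (hnn i))]
  congr 1
  ext x
  by_cases hx : x ∈ s i <;> simp [hx]

theorem map_add_gaussianPi {v : NNReal} (hv : v ≠ 0) (a : ι → ℝ) :
    (gaussianPi ι v).map (fun x => x + a) =
      (gaussianPi ι v).withDensity fun x => ENNReal.ofReal (gaussianLikelihood v a x) := by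
  rw [← pi_gaussianReal_eq_withDensity hv]
  have h : ∀ i, (gaussianReal 0 v).map (fun x => x + a i) = gaussianReal (a i) v := fun i => by
    rw [gaussianReal_map_add_const, zero_add]
  have := Measure.pi_map_pi (μ := fun _ : ι => gaussianReal 0 v) (f := fun i x => x + a i)
    (fun i => by fun_prop)
  simp only [h] at this
  exact this

theorem memLp_gaussianLikelihood (v : NNReal) (a : ι → ℝ) :
    MemLp (gaussianLikelihood v a) 2 (gaussianPi ι v) := by
  rw [memLp_two_iff_integrable_sq (measurable_gaussianLikelihood _ _).aestronglyMeasurable]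
  have := Integrable.fintype_prod (μ := fun _ : ι => gaussianReal 0 v)
    (f := fun i x => gaussianShiftDensity v (a i) x ^ 2)
    fun i => integrable_gaussianShiftDensity_sq v (a i)
  simpa [gaussianLikelihood, Finset.prod_pow] using this

/-- Subtracting 1 gives the $\chi^2$-divergence of the shifted law, which is the denominator in the
Chapman–Robbins inequality. -/
theorem integral_gaussianLikelihood_sq {v : NNReal} (hv : v ≠ 0) (a : ι → ℝ) :
    ∫ x, gaussianLikelihood v a x ^ 2 ∂(gaussianPi ι v) = Real.exp ((∑ i, a i ^ 2) / v) := by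
  have := integral_fintype_prod_eq_prod (μ := fun _ : ι => gaussianReal 0 v) (𝕜 := ℝ)
    (fun i x => gaussianShiftDensity v (a i) x ^ 2)
  simp only [integral_gaussianShiftDensity_sq hv, Finset.prod_pow] at this
  rw [Finset.sum_div, Real.exp_sum]
  exact this

theorem integral_gaussianLikelihood {v : NNReal} (hv : v ≠ 0) (a : ι → ℝ) :
    ∫ x, gaussianLikelihood v a x ∂(gaussianPi ι v) = 1 := by
  have h := congrArg (fun m => m Set.univ) (pi_gaussianReal_eq_withDensity hv a)
  simp only [measure_univ, withDensity_apply _ MeasurableSet.univ, Measure.restrict_univ] at h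
  rw [integral_eq_lintegral_of_nonneg_ae (.of_forall fun x => gaussianLikelihood_nonneg _ _ _)
    (measurable_gaussianLikelihood _ _).aestronglyMeasurable, ← h]
  simp

/-- Change of measure; no integrability of `f` is assumed, since absolute continuity of the shifted
law already transfers measurability. -/
theorem integral_comp_add_gaussianPi {v : NNReal} (hv : v ≠ 0) (a : ι → ℝ) {f : (ι → ℝ) → ℝ}
    (hf : AEStronglyMeasurable f (gaussianPi ι v)) :
    ∫ x, f (x + a) ∂(gaussianPi ι v) =
      ∫ x, gaussianLikelihood v a x * f x ∂(gaussianPi ι v) := by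
  have hac : (gaussianPi ι v).map (fun x => x + a) ≪ gaussianPi ι v := by
    rw [map_add_gaussianPi hv]
    exact withDensity_absolutelyContinuous _ _
  rw [← integral_map (φ := fun x => x + a) (by fun_prop) (hf.mono_ac hac), map_add_gaussianPi hv,
    integral_withDensity_eq_integral_toReal_smul
      (measurable_gaussianLikelihood _ _).ennreal_ofReal (by simp)]
  simp [ENNReal.toReal_ofReal (gaussianLikelihood_nonneg _ _ _)]

/-- A multivariate Chapman–Robbins inequality for Gaussian shifts, with a free scale `x`. -/
theorem chapmanRobbins_gaussianPi {v : NNReal} (hv : v ≠ 0) {α : Type*} [Fintype α]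
    (a : α → ι → ℝ) (f : α → (ι → ℝ) → ℝ) (hf : ∀ k, MemLp (f k) 2 (gaussianPi ι v)) (x : ℝ) :
    2 * x * ∑ k, ((∫ e, f k (e + a k) ∂(gaussianPi ι v)) - ∫ e, f k e ∂(gaussianPi ι v)) -
        x ^ 2 * ∑ k, (Real.exp ((∑ i, a k i ^ 2) / v) - 1) ≤
      ∫ e, ∑ k, f k e ^ 2 ∂(gaussianPi ι v) := by
  have hL : ∀ k, MemLp (fun e => gaussianLikelihood v (a k) e - 1) 2 (gaussianPi ι v) :=
    fun k => (memLp_gaussianLikelihood v (a k)).sub (memLp_const 1)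
  have hfL : ∀ k, Integrable (fun e => (gaussianLikelihood v (a k) e - 1) * f k e)
    (gaussianPi ι v) := fun k => (hL k).integrable_mul (hf k)
  have h1 : ∀ k, (∫ e, f k (e + a k) ∂(gaussianPi ι v)) - ∫ e, f k e ∂(gaussianPi ι v) =
      ∫ e, (gaussianLikelihood v (a k) e - 1) * f k e ∂(gaussianPi ι v) := by
    intro k
    have hi : Integrable (fun e => gaussianLikelihood v (a k) e * f k e) (gaussianPi ι v) :=
      (memLp_gaussianLikelihood v (a k)).integrable_mul (hf k)
    rw [integral_comp_add_gaussianPi hv _ (hf k).1,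
      ← integral_sub hi ((hf k).integrable (by norm_num))]
    congr 1
    ext e
    ring
  have h2 : ∀ k, Real.exp ((∑ i, a k i ^ 2) / v) - 1 =
      ∫ e, (gaussianLikelihood v (a k) e - 1) ^ 2 ∂(gaussianPi ι v) := by
    intro k
    have : (fun e => (gaussianLikelihood v (a k) e - 1) ^ 2) =
        fun e => gaussianLikelihood v (a k) e ^ 2 - (2 * gaussianLikelihood v (a k) e - 1) := by
      ext e
      ring
    have hi : Integrable (fun e => 2 * gaussianLikelihood v (a k) e - 1) (gaussianPi ι v) :=
      ((integrable_gaussianLikelihood v (a k)).const_mul 2).sub (integrable_const 1)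
    rw [this, integral_sub (memLp_gaussianLikelihood v (a k)).integrable_sq hi,
      integral_sub ((integrable_gaussianLikelihood v (a k)).const_mul 2) (integrable_const 1),
      integral_const_mul, integral_gaussianLikelihood hv, integral_gaussianLikelihood_sq hv]
    simp
    ring
  simp only [h1, h2]
  rw [integral_finsetSum _ fun k _ => (hf k).integrable_sq, Finset.mul_sum, Finset.mul_sum,
    ← Finset.sum_sub_distrib]
  refine Finset.sum_le_sum fun k _ => ?_
  rw [← integral_const_mul, ← integral_const_mul, ← integral_sub ((hfL k).const_mul _)
    ((hL k).integrable_sq.const_mul _)]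
  refine integral_mono (((hfL k).const_mul _).sub ((hL k).integrable_sq.const_mul _))
    (hf k).integrable_sq fun e => ?_
  simp only
  -- Pointwise $2xLf-x^2L^2\le f^2$ with $L$ the likelihood ratio minus 1; this replaces
  -- Cauchy–Schwarz and keeps the scale `x` common to all `k`.
  nlinarith [sq_nonneg (f k e - x * (gaussianLikelihood v (a k) e - 1))]

end GaussianShift

/-! ### Upper tail of a weighted Bernoulli sum. -/

section Chernoff

open Classical in
/-- The total weight of the selected indices. -/
noncomputable def selectedWeight {ι : Type*} [Fintype ι] (w : ι → ℝ) (s : Set ι) : ℝ :=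
  ∑ i, if i ∈ s then w i else 0

variable {ι : Type*} [Fintype ι]

theorem integral_exp_selectedWeight (p : unitInterval) (w : ι → ℝ) :
    ∫ s, Real.exp (selectedWeight w s) ∂(setBernoulli Set.univ p) =
      ∏ i, (1 + p * (Real.exp (w i) - 1)) := by
  classical
  have hprod : ∀ s : Set ι, Real.exp (selectedWeight w s) =
      ∏ i, (if i ∈ s then Real.exp (w i) else 1) := by
    intro s
    rw [selectedWeight, Real.exp_sum]
    refine Finset.prod_congr rfl fun i _ => ?_
    split_ifs <;> simp
  rw [setBernoulli_eq_map, Measure.infinitePi_eq_pi,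
    integral_map (by fun_prop) (by exact AEStronglyMeasurable.of_discrete)]
  simp only [hprod, Set.mem_ofPred_eq]
  rw [integral_fintype_prod_eq_prod (𝕜 := ℝ)
    (f := fun i (q : Prop) => if q then Real.exp (w i) else (1 : ℝ))]
  refine Finset.prod_congr rfl fun i _ => ?_
  rw [integral_add_measure (.of_finite) (.of_finite), integral_smul_nnreal_measure,
    integral_smul_nnreal_measure, integral_dirac, integral_dirac]
  simp [NNReal.smul_def]
  ring

/-- A multiplicative Chernoff bound for weighted sums of independent Bernoulli variables. -/
theorem setBernoulli_real_selectedWeight_ge_le (p : unitInterval) {w : ι → ℝ} {A m δ : ℝ}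
    (hw : ∀ i, 0 ≤ w i) (hwm : ∀ i, w i ≤ m) (hm : 0 < m) (hA : ∑ i, w i ≤ A)
    (hδ : 0 ≤ δ) (hδ2 : δ ≤ 2) :
    (setBernoulli Set.univ p).real {s | (1 + δ) * (p * A) ≤ selectedWeight w s} ≤
      Real.exp (-(δ ^ 2 * (p * A) / (4 * m))) := by
  have hp : 0 ≤ (p : ℝ) := p.2.1
  -- With this `t`, every $tw_i\le\delta/2\le1$, so $e^{tw_i}-1\le tw_i(1+\delta/2)$. Half of the
  -- deviation $\delta$ is lost there, and the other half leaves the exponent $-tpA\,\delta/2$.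
  set t : ℝ := δ / (2 * m) with ht
  have ht0 : 0 ≤ t := by positivity
  have htm : t * m = δ / 2 := by rw [ht]; field_simp
  have hmgf : mgf (selectedWeight w) (setBernoulli Set.univ p) t ≤
      Real.exp (t * (p * A) * (1 + δ / 2)) := by
    have h1 : mgf (selectedWeight w) (setBernoulli Set.univ p) t =
        ∏ i, (1 + p * (Real.exp (t * w i) - 1)) := by
      rw [← integral_exp_selectedWeight p (fun i => t * w i), mgf]
      congr 1
      ext s
      simp [selectedWeight, Finset.mul_sum]
    rw [h1]
    calc ∏ i, (1 + p * (Real.exp (t * w i) - 1))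
        ≤ ∏ i, Real.exp (p * (t * w i * (1 + δ / 2))) := by
          refine Finset.prod_le_prod (fun i _ => ?_) fun i _ => ?_
          · have := Real.one_le_exp (mul_nonneg ht0 (hw i))
            nlinarith
          · have h0 : 0 ≤ t * w i := mul_nonneg ht0 (hw i)
            have h2 : t * w i ≤ δ / 2 := htm ▸ mul_le_mul_of_nonneg_left (hwm i) ht0
            have h3 : Real.exp (t * w i) - 1 ≤ t * w i * (1 + δ / 2) := by
              have := Real.abs_exp_sub_one_sub_id_le (x := t * w i) (by rw [abs_of_nonneg h0]; linarith)
              have := (abs_le.1 this).2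
              nlinarith
            have h4 := mul_le_mul_of_nonneg_left h3 hp
            linarith [Real.add_one_le_exp (p * (t * w i * (1 + δ / 2)))]
      _ = Real.exp (t * (p * ∑ i, w i) * (1 + δ / 2)) := by
          rw [← Real.exp_sum]
          congr 1
          rw [Finset.mul_sum, Finset.mul_sum, Finset.sum_mul]
          exact Finset.sum_congr rfl fun i _ => by ring
      _ ≤ _ := by gcongr
  refine (measure_ge_le_exp_mul_mgf _ ht0 .of_finite).trans ?_
  refine (mul_le_mul_of_nonneg_left hmgf (Real.exp_pos _).le).trans ?_
  rw [← Real.exp_add, Real.exp_le_exp]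
  rw [ht]
  field_simp
  nlinarith [sq_nonneg δ]

end Chernoff

/-! ### Symmetric functions of index triples. -/

section Symmetry

variable {d r : ℕ}

theorem apply_sortTriple {β : Type*} {f : Fin d → Fin d → Fin d → β}
    (h₁ : ∀ a b c, f a b c = f b a c) (h₂ : ∀ a b c, f a b c = f a c b) (i j k : Fin d) :
    f (sortTriple i j k).1.1 (sortTriple i j k).1.2.1 (sortTriple i j k).1.2.2 = f i j k := by
  simp only [sortTriple]
  rcases le_total i j with hij | hij <;> rcases le_total j k with hjk | hjk <;>
    rcases le_total i k with hik | hik <;> simp [hij, hjk, hik] <;> grind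

theorem cpTensor_swap_left (U : Factors d r) (a b c : Fin d) :
    cpTensor U a b c = cpTensor U b a c :=
  Finset.sum_congr rfl fun _ _ => by ring

theorem cpTensor_swap_right (U : Factors d r) (a b c : Fin d) :
    cpTensor U a b c = cpTensor U a c b :=
  Finset.sum_congr rfl fun _ _ => by ring

end Symmetry

/-! ### Information along a direction and the Cramér–Rao bound. -/

section Information

variable {d r : ℕ}

/-- The directional derivative of `cpTensor` at `U` in the direction `H`. -/
noncomputable def cpDeriv (U H : Factors d r) : Tensor d :=
  fun a b c => ∑ l, (H l a * U l b * U l c + U l a * H l b * U l c + U l a * U l b * H l c)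

theorem hasDerivAt_cpTensor (U H : Factors d r) (a b c : Fin d) :
    HasDerivAt (fun s : ℝ => cpTensor (U + s • H) a b c) (cpDeriv U H a b c) 0 := by
  unfold cpTensor cpDeriv
  refine HasDerivAt.fun_sum fun l _ => ?_
  have hcoord : ∀ i : Fin d, HasDerivAt (fun s : ℝ => (U + s • H) l i) (H l i) 0 := fun i => by
    simpa using ((hasDerivAt_id (0 : ℝ)).mul_const (H l i)).const_add (U l i)
  have := ((hcoord a).fun_mul (hcoord b)).fun_mul (hcoord c)
  exact this.congr_deriv (by simp; ring)

open Classical in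
/-- The change of the observed means, when the factors change from `U` to `V`. -/
noncomputable def meanShift (ω : Set (OrderedTriple d)) (U V : Factors d r) :
    OrderedTriple d → ℝ :=
  fun t => if t ∈ ω then cpTensor V t.1.1 t.1.2.1 t.1.2.2 - cpTensor U t.1.1 t.1.2.1 t.1.2.2 else 0

/-- Changing the factors acts on the data as a deterministic shift of the noise; this puts all the
data laws into one Gaussian shift family. -/
theorem projOn_cpTensor_add_noiseTensor (ω : Set (OrderedTriple d)) (U V : Factors d r)
    (e : OrderedTriple d → ℝ) :
    projOn (symmSet ω) (cpTensor V + noiseTensor e) =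
      projOn (symmSet ω) (cpTensor U + noiseTensor (e + meanShift ω U V)) := by
  ext i j k
  simp only [projOn]
  split_ifs with h
  · have h' : sortTriple i j k ∈ ω := h
    simp only [Pi.add_apply, noiseTensor, meanShift, if_pos h',
      apply_sortTriple (cpTensor_swap_left U) (cpTensor_swap_right U),
      apply_sortTriple (cpTensor_swap_left V) (cpTensor_swap_right V)]
    ring
  · rfl

theorem measurable_observation (Ω : Set (Fin d × Fin d × Fin d)) (T : Tensor d) :
    Measurable fun e => projOn Ω (T + noiseTensor e) := by
  refine measurable_pi_iff.2 fun i => measurable_pi_iff.2 fun j => measurable_pi_iff.2 fun k => ?_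
  by_cases h : (i, j, k) ∈ Ω
  · simp only [projOn, if_pos h, Pi.add_apply, noiseTensor]
    fun_prop
  · simp only [projOn, if_neg h]
    fun_prop

/-- Writing $e^q-1$ as $q$ times the continuous divided difference of $\exp$ at 0 avoids dividing by
`q s`, which may vanish. -/
theorem tendsto_exp_sub_one_div_sq {q : ℝ → ℝ} {L : ℝ}
    (hq : Tendsto (fun s => q s / s ^ 2) (𝓝[>] 0) (𝓝 L)) :
    Tendsto (fun s => (Real.exp (q s) - 1) / s ^ 2) (𝓝[>] 0) (𝓝 L) := by
  have hs : Tendsto (fun s : ℝ => s ^ 2) (𝓝[>] 0) (𝓝 0) := by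
    have : Tendsto (fun s : ℝ => s ^ 2) (𝓝 0) (𝓝 (0 ^ 2)) := (continuous_pow 2).tendsto 0
    simpa using this.mono_left nhdsWithin_le_nhds
  have hpos : ∀ᶠ s : ℝ in 𝓝[>] 0, 0 < s := self_mem_nhdsWithin
  have hq0 : Tendsto q (𝓝[>] 0) (𝓝 0) := by
    have := hq.mul hs
    rw [mul_zero] at this
    refine this.congr' ?_
    filter_upwards [hpos] with s hs
    field_simp
  have hc : ContinuousAt (dslope Real.exp 0) 0 :=
    continuousAt_dslope_same.2 Real.differentiableAt_exp
  have h1 : dslope Real.exp 0 0 = 1 := by simp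
  have := (hc.tendsto.comp hq0).mul hq
  rw [h1, one_mul] at this
  refine this.congr fun s => ?_
  have := sub_smul_dslope Real.exp 0 (q s)
  rw [Real.exp_zero, sub_zero, smul_eq_mul] at this
  rw [← this, Function.comp_apply]
  ring

theorem tendsto_meanShift_sq (ω : Set (OrderedTriple d)) (U H : Factors d r) :
    Tendsto (fun s : ℝ => (∑ t, meanShift ω U (U + s • H) t ^ 2) / s ^ 2) (𝓝[>] 0)
      (𝓝 (selectedWeight (fun t => cpDeriv U H t.1.1 t.1.2.1 t.1.2.2 ^ 2) ω)) := by
  simp only [Finset.sum_div, selectedWeight]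
  refine tendsto_finsetSum _ fun t _ => ?_
  by_cases ht : t ∈ ω
  · simp only [meanShift, if_pos ht]
    have h := (hasDerivAt_iff_tendsto_slope.1 (hasDerivAt_cpTensor U H t.1.1 t.1.2.1 t.1.2.2)).mono_left
      (nhdsWithin_mono 0 fun s (hs : 0 < s) => (ne_of_gt hs : s ≠ 0))
    refine (h.pow 2).congr fun s => ?_
    simp [slope_def_field, div_pow]
  · simp [meanShift, if_neg ht]

/-- The Cramér–Rao bound in the form that is obtained by testing with finitely many
directions `H k` and functionals `φ k`. -/
theorem LocallyUnbiasedAt.risk_ge {F : Type*} [NormedAddCommGroup F] [NormedSpace ℝ F]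
    [CompleteSpace F] {ω : Set (OrderedTriple d)} {σ : ℝ} (hσ : 0 < σ) {U : Factors d r}
    {target : Factors d r → F} {est : Tensor d → F}
    (hest : LocallyUnbiasedAt (symmSet ω) σ U target est) {α : Type*} [Fintype α]
    (φ : α → F →L[ℝ] ℝ) (H : α → Factors d r) (D : α → ℝ)
    (hD : ∀ k, HasDerivAt (fun s : ℝ => φ k (target (U + s • H k))) (D k) 0) (c : ℝ) :
    ENNReal.ofReal (2 * c * ∑ k, D k - c ^ 2 *
        ((∑ k, selectedWeight (fun t => cpDeriv U (H k) t.1.1 t.1.2.1 t.1.2.2 ^ 2) ω) / σ ^ 2)) ≤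
      ∫⁻ y, ENNReal.ofReal (∑ k, (φ k (est y) - φ k (target U)) ^ 2)
        ∂(dataLaw (symmSet ω) σ U) := by
  obtain ⟨hint, hlit⟩ := hest
  set Ω := symmSet ω with hΩ
  set v : NNReal := (σ ^ 2).toNNReal with hv
  have hvσ : (v : ℝ) = σ ^ 2 := Real.coe_toNNReal _ (by positivity)
  have hv0 : v ≠ 0 := by
    intro h
    rw [h, NNReal.coe_zero] at hvσ
    exact (pow_pos hσ 2).ne hvσ
  set N := gaussianPi (OrderedTriple d) v with hN
  set Φ : (OrderedTriple d → ℝ) → Tensor d := fun e => projOn Ω (cpTensor U + noiseTensor e)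
    with hΦ
  have hΦm : Measurable Φ := measurable_observation _ _
  have hlaw : ∀ V, dataLaw Ω σ V = N.map fun e => Φ (e + meanShift ω U V) := fun V => by
    simp only [dataLaw, hΦ, hΩ]
    congr 1
    ext e : 1
    exact projOn_cpTensor_add_noiseTensor ω U V e
  have hlawU : dataLaw Ω σ U = N.map Φ := rfl
  have hΦa : ∀ a, Measurable fun e => Φ (e + a) := fun a => hΦm.comp (measurable_id.add_const a)
  have hestU : Integrable est (dataLaw Ω σ U) := hint.self_of_nhds
  -- The first-order error is $o(\|U-U^\star\|)$, hence zero at $U^\star$ itself: the estimator is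
  -- exactly unbiased there.
  have hmeanU : ∫ y, est y ∂(dataLaw Ω σ U) = target U :=
    sub_eq_zero.1 (hlit.isBigO.eq_zero_imp.self_of_nhds (sub_self U))
  have hφU : ∀ k, AEStronglyMeasurable (fun y => φ k (est y)) (N.map Φ) := fun k =>
    (φ k).continuous.comp_aestronglyMeasurable (hlawU ▸ hestU.1)
  set f : α → (OrderedTriple d → ℝ) → ℝ := fun k e => φ k (est (Φ e)) - φ k (target U) with hf
  have hfm : ∀ k, AEStronglyMeasurable (f k) N := fun k =>
    ((hφU k).comp_measurable hΦm).sub aestronglyMeasurable_const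
  have hrisk : ∫⁻ y, ENNReal.ofReal (∑ k, (φ k (est y) - φ k (target U)) ^ 2) ∂(dataLaw Ω σ U) =
      ∫⁻ e, ENNReal.ofReal (∑ k, f k e ^ 2) ∂N := by
    rw [hlawU, lintegral_map' _ hΦm.aemeasurable]
    refine AEMeasurable.ennreal_ofReal (Finset.aemeasurable_fun_sum _ fun k _ => ?_)
    exact ((hφU k).aemeasurable.sub_const _).pow_const 2
  rw [hrisk]
  -- An infinite tested risk makes the bound trivial; otherwise every `f k` is square integrable
  -- under the law at `U`, and no second moment at nearby parameters is needed.
  by_cases htop : ∫⁻ e, ENNReal.ofReal (∑ k, f k e ^ 2) ∂N = ⊤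
  · rw [htop]
    exact le_top
  have hf2 : ∀ k, MemLp (f k) 2 N := fun k => by
    rw [memLp_two_iff_integrable_sq (hfm k)]
    refine ⟨(hfm k).pow 2, ?_⟩
    rw [hasFiniteIntegral_iff_ofReal (.of_forall fun e => sq_nonneg _)]
    refine lt_of_le_of_lt (lintegral_mono fun e => ENNReal.ofReal_le_ofReal ?_)
      (lt_top_iff_ne_top.2 htop)
    exact Finset.single_le_sum (f := fun k => f k e ^ 2) (fun k _ => sq_nonneg _)
      (Finset.mem_univ k)
  rw [← ofReal_integral_eq_lintegral_ofReal (integrable_finsetSum _ fun k _ => (hf2 k).integrable_sq)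
    (.of_forall fun e => Finset.sum_nonneg fun k _ => sq_nonneg _)]
  refine ENNReal.ofReal_le_ofReal ?_
  have hline : ∀ k, Tendsto (fun s : ℝ => U + s • H k) (𝓝[>] 0) (𝓝 U) := fun k => by
    have : Tendsto (fun s : ℝ => U + s • H k) (𝓝 0) (𝓝 (U + (0 : ℝ) • H k)) :=
      Continuous.tendsto (by fun_prop) 0
    rw [zero_smul, add_zero] at this
    exact this.mono_left nhdsWithin_le_nhds
  have hfU : ∀ k, ∫ e, f k e ∂N = 0 := fun k => by
    have h1 : Integrable (fun e => est (Φ e)) N := (hlawU ▸ hestU).comp_measurable hΦm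
    rw [hf, integral_sub ((φ k).integrable_comp h1) (integrable_const _),
      (φ k).integral_comp_comm h1, ← integral_map hΦm.aemeasurable (hlawU ▸ hestU.1), ← hlawU,
      hmeanU]
    simp
  have hfV : ∀ k V, Integrable est (dataLaw Ω σ V) → ∫ e, f k (e + meanShift ω U V) ∂N =
      φ k (∫ y, est y ∂(dataLaw Ω σ V)) - φ k (target U) := fun k V hV => by
    rw [hlaw] at hV
    have h1 : Integrable (fun e => est (Φ (e + meanShift ω U V))) N := hV.comp_measurable (hΦa _)
    rw [hf, integral_sub ((φ k).integrable_comp h1) (integrable_const _),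
      (φ k).integral_comp_comm h1, hlaw, integral_map (hΦa _).aemeasurable hV.1]
    simp
  have hmean : ∀ k, Tendsto (fun s : ℝ => ((∫ e, f k (e + meanShift ω U (U + s • H k)) ∂N) -
      ∫ e, f k e ∂N) / s) (𝓝[>] 0) (𝓝 (D k)) := fun k => by
    have h1 := (hasDerivAt_iff_tendsto_slope.1 (hD k)).mono_left
      (nhdsWithin_mono 0 fun s (hs : 0 < s) => (ne_of_gt hs : s ≠ 0))
    -- Local unbiasedness enters here: along a line the bias is $o(s)$, so the difference quotient
    -- of the mean has the same limit as that of the target.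
    have h2 : (fun s : ℝ => φ k ((∫ y, est y ∂(dataLaw Ω σ (U + s • H k))) -
        target (U + s • H k))) =o[𝓝[>] 0] fun s : ℝ => s := by
      have h3 := hlit.comp_tendsto (hline k)
      refine ((φ k).isBigO_comp _ _).trans_isLittleO (h3.trans_isBigO ?_)
      simp only [Function.comp_def, add_sub_cancel_left]
      exact isBigO_of_le' (c := ‖H k‖) _ fun s => by rw [norm_smul, mul_comm]
    have h4 := h1.add h2.tendsto_div_nhds_zero
    rw [add_zero] at h4
    refine h4.congr' ?_
    filter_upwards [(hline k).eventually hint] with s hs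
    rw [hfU, hfV k _ hs, slope_def_field, map_sub]
    simp only [zero_smul, add_zero, sub_zero]
    ring
  have hinfo : ∀ k, Tendsto (fun s : ℝ =>
      (Real.exp ((∑ t, meanShift ω U (U + s • H k) t ^ 2) / v) - 1) / s ^ 2) (𝓝[>] 0)
      (𝓝 (selectedWeight (fun t => cpDeriv U (H k) t.1.1 t.1.2.1 t.1.2.2 ^ 2) ω / σ ^ 2)) :=
    fun k => by
      refine tendsto_exp_sub_one_div_sq ?_
      refine ((tendsto_meanShift_sq ω U (H k)).div_const (σ ^ 2)).congr fun s => ?_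
      rw [hvσ]
      ring
  have hlim : Tendsto (fun s : ℝ => 2 * c * ∑ k, ((∫ e, f k (e + meanShift ω U (U + s • H k)) ∂N) -
      ∫ e, f k e ∂N) / s - c ^ 2 * ∑ k,
      (Real.exp ((∑ t, meanShift ω U (U + s • H k) t ^ 2) / v) - 1) / s ^ 2) (𝓝[>] 0)
      (𝓝 (2 * c * ∑ k, D k - c ^ 2 * ((∑ k, selectedWeight
        (fun t => cpDeriv U (H k) t.1.1 t.1.2.1 t.1.2.2 ^ 2) ω) / σ ^ 2))) := by
    rw [Finset.sum_div]
    exact ((tendsto_finsetSum _ fun k _ => hmean k).const_mul _).sub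
      ((tendsto_finsetSum _ fun k _ => hinfo k).const_mul _)
  refine le_of_tendsto hlim ?_
  filter_upwards [self_mem_nhdsWithin] with s (hs : 0 < s)
  -- The scale $c/s$ turns mean differences into difference quotients and divides the $\chi^2$ terms
  -- by $s^2$.
  refine le_trans (le_of_eq ?_) (chapmanRobbins_gaussianPi hv0
    (fun k => meanShift ω U (U + s • H k)) f hf2 (c / s))
  rw [← Finset.sum_div, ← Finset.sum_div, ← hN]
  field_simp

end Information

/-! ### Sums over ordered triples compared with sums over all triples. -/

section SumsOverTriples

variable {d : ℕ}

theorem sum_triple_mul (p q s : Fin d → ℝ) :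
    ∑ t : Fin d × Fin d × Fin d, p t.1 * q t.2.1 * s t.2.2 = (∑ i, p i) * (∑ i, q i) * ∑ i, s i := by
  simp only [Fintype.sum_prod_type, ← Finset.mul_sum, ← Finset.sum_mul]

theorem sum_orderedTriple_eq (f : Fin d → Fin d → Fin d → ℝ) :
    ∑ t : OrderedTriple d, f t.1.1 t.1.2.1 t.1.2.2 =
      ∑ a, ∑ b, ∑ c, if a ≤ b ∧ b ≤ c then f a b c else 0 := by
  rw [← Finset.sum_subtype
    (Finset.univ.filter fun t : Fin d × Fin d × Fin d => t.1 ≤ t.2.1 ∧ t.2.1 ≤ t.2.2) (by simp)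
    (fun t => f t.1 t.2.1 t.2.2), Finset.sum_filter]
  simp only [Fintype.sum_prod_type]

/-- The six permutations of a strictly increasing triple are disjoint and carry equal values; this
is the origin of the factor $1/6$. -/
theorem sum_strictly_ordered_le {f : Fin d → Fin d → Fin d → ℝ} (h0 : ∀ a b c, 0 ≤ f a b c)
    (h₁ : ∀ a b c, f a b c = f b a c) (h₂ : ∀ a b c, f a b c = f a c b) :
    6 * ∑ a, ∑ b, ∑ c, (if a < b ∧ b < c then f a b c else 0) ≤ ∑ a, ∑ b, ∑ c, f a b c := by
  have swapL : ∀ F : Fin d → Fin d → Fin d → ℝ,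
      ∑ a, ∑ b, ∑ c, F a b c = ∑ a, ∑ b, ∑ c, F b a c := fun F => Finset.sum_comm
  have swapR : ∀ F : Fin d → Fin d → Fin d → ℝ,
      ∑ a, ∑ b, ∑ c, F a b c = ∑ a, ∑ b, ∑ c, F a c b :=
    fun F => Finset.sum_congr rfl fun _ _ => Finset.sum_comm
  set F : Fin d → Fin d → Fin d → ℝ := fun a b c => if a < b ∧ b < c then f a b c else 0 with hF
  have e1 := swapL F
  have e2 := swapR F
  have e3 := swapR fun a b c => F b a c
  have e4 := swapL fun a b c => F a c b
  have e5 := swapR fun a b c => F b c a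
  have key : ∑ a, ∑ b, ∑ c, (F a b c + F b a c + F a c b + F c a b + F b c a + F c b a) ≤
      ∑ a, ∑ b, ∑ c, f a b c := by
    refine Finset.sum_le_sum fun a _ => Finset.sum_le_sum fun b _ => Finset.sum_le_sum fun c _ => ?_
    have := h0 a b c
    have e1 : f b a c = f a b c := (h₁ a b c).symm
    have e2 : f a c b = f a b c := (h₂ a b c).symm
    have e3 : f c a b = f a b c := by rw [h₁, h₂]
    have e4 : f b c a = f a b c := by rw [h₂, h₁]
    have e5 : f c b a = f a b c := by rw [h₁, h₂, h₁]
    simp only [hF, e1, e2, e3, e4, e5]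
    split_ifs <;> first | omega | linarith
  simp only [Finset.sum_add_distrib] at key
  linarith

/-- An ordered triple is strictly increasing or has two equal neighbours; by symmetry the two
diagonal sums coincide. They are of lower order in the applications. -/
theorem sum_orderedTriple_le {f : Fin d → Fin d → Fin d → ℝ} (h0 : ∀ a b c, 0 ≤ f a b c)
    (h₁ : ∀ a b c, f a b c = f b a c) (h₂ : ∀ a b c, f a b c = f a c b) :
    ∑ t : OrderedTriple d, f t.1.1 t.1.2.1 t.1.2.2 ≤
      (∑ a, ∑ b, ∑ c, f a b c) / 6 + 2 * ∑ a, ∑ c, f a a c := by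
  rw [sum_orderedTriple_eq]
  have hdiag₁ : ∑ a, ∑ b, ∑ c, (if a = b then f a b c else 0) = ∑ a, ∑ c, f a a c := by
    refine Finset.sum_congr rfl fun a _ => ?_
    rw [Finset.sum_comm]
    simp
  have hdiag₂ : ∑ a, ∑ b, ∑ c, (if b = c then f a b c else 0) = ∑ a, ∑ c, f a a c := by
    rw [Finset.sum_comm (f := fun a c => f a a c)]
    refine Finset.sum_congr rfl fun a _ => Finset.sum_congr rfl fun b _ => ?_
    simp only [Finset.sum_ite_eq, Finset.mem_univ, if_true]
    rw [h₁, h₂]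
  have hle : ∑ a, ∑ b, ∑ c, (if a ≤ b ∧ b ≤ c then f a b c else 0) ≤
      ∑ a, ∑ b, ∑ c, ((if a < b ∧ b < c then f a b c else 0) + (if a = b then f a b c else 0) +
        (if b = c then f a b c else 0)) := by
    refine Finset.sum_le_sum fun a _ => Finset.sum_le_sum fun b _ => Finset.sum_le_sum fun c _ => ?_
    have := h0 a b c
    split_ifs <;> first | omega | linarith
  simp only [Finset.sum_add_distrib] at hle
  linarith [sum_strictly_ordered_le h0 h₁ h₂]

end SumsOverTriples

/-! ### The symmetrized slot map, its Gram form and its gradients. -/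

section SymmetrizedSlot

variable {d : ℕ}

/-- The entries of `h ⊗ x ⊗ x + x ⊗ h ⊗ x + x ⊗ x ⊗ h`. -/
def symSlot (x h : Fin d → ℝ) (t : Fin d × Fin d × Fin d) : ℝ :=
  h t.1 * x t.2.1 * x t.2.2 + x t.1 * h t.2.1 * x t.2.2 + x t.1 * x t.2.1 * h t.2.2

/-- The gradient of `h ↦ symSlot x h t`. -/
def slotGrad (x : Fin d → ℝ) (t : Fin d × Fin d × Fin d) : Fin d → ℝ :=
  fun i => symSlot x (Pi.single i 1) t

theorem symSlot_eq_dotProduct (x h : Fin d → ℝ) (t : Fin d × Fin d × Fin d) :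
    symSlot x h t = h ⬝ᵥ slotGrad x t := by
  simp only [dotProduct, slotGrad, symSlot, mul_add, Finset.sum_add_distrib, Pi.single_apply,
    mul_ite, ite_mul, one_mul, zero_mul, mul_one, mul_zero, Finset.sum_ite_eq, Finset.mem_univ,
    if_true]
  ring

theorem symSlot_swap_left (x h : Fin d → ℝ) (a b c : Fin d) :
    symSlot x h (a, b, c) = symSlot x h (b, a, c) := by
  simp only [symSlot]; ring

theorem symSlot_swap_right (x h : Fin d → ℝ) (a b c : Fin d) :
    symSlot x h (a, b, c) = symSlot x h (a, c, b) := by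
  simp only [symSlot]; ring

theorem slotGrad_swap_left (x : Fin d → ℝ) (a b c : Fin d) :
    slotGrad x (a, b, c) = slotGrad x (b, a, c) :=
  funext fun _ => symSlot_swap_left _ _ _ _ _

theorem slotGrad_swap_right (x : Fin d → ℝ) (a b c : Fin d) :
    slotGrad x (a, b, c) = slotGrad x (a, c, b) :=
  funext fun _ => symSlot_swap_right _ _ _ _ _

theorem symSlot_smul_right (s : ℝ) (x h : Fin d → ℝ) (t : Fin d × Fin d × Fin d) :
    symSlot x (s • h) t = s * symSlot x h t := by
  simp only [symSlot, Pi.smul_apply, smul_eq_mul]; ring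

/-- Of the nine products of slots, three place `h` and `k` in the same position and six in different
ones. For $x=y$ of unit length the Gram form is $3I+6xx^\top$. -/
theorem sum_symSlot_mul_symSlot (x h y k : Fin d → ℝ) :
    ∑ t, symSlot x h t * symSlot y k t =
      3 * (h ⬝ᵥ k) * (x ⬝ᵥ y) ^ 2 + 6 * (h ⬝ᵥ y) * (x ⬝ᵥ k) * (x ⬝ᵥ y) := by
  have expand : ∀ t : Fin d × Fin d × Fin d, symSlot x h t * symSlot y k t =
      (h t.1 * k t.1) * (x t.2.1 * y t.2.1) * (x t.2.2 * y t.2.2) +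
      (h t.1 * y t.1) * (x t.2.1 * k t.2.1) * (x t.2.2 * y t.2.2) +
      (h t.1 * y t.1) * (x t.2.1 * y t.2.1) * (x t.2.2 * k t.2.2) +
      (x t.1 * k t.1) * (h t.2.1 * y t.2.1) * (x t.2.2 * y t.2.2) +
      (x t.1 * y t.1) * (h t.2.1 * k t.2.1) * (x t.2.2 * y t.2.2) +
      (x t.1 * y t.1) * (h t.2.1 * y t.2.1) * (x t.2.2 * k t.2.2) +
      (x t.1 * k t.1) * (x t.2.1 * y t.2.1) * (h t.2.2 * y t.2.2) +
      (x t.1 * y t.1) * (x t.2.1 * k t.2.1) * (h t.2.2 * y t.2.2) +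
      (x t.1 * y t.1) * (x t.2.1 * y t.2.1) * (h t.2.2 * k t.2.2) := fun t => by
    simp only [symSlot]; ring
  simp only [expand, Finset.sum_add_distrib]
  rw [sum_triple_mul (fun i => h i * k i) (fun i => x i * y i) (fun i => x i * y i),
    sum_triple_mul (fun i => h i * y i) (fun i => x i * k i) (fun i => x i * y i),
    sum_triple_mul (fun i => h i * y i) (fun i => x i * y i) (fun i => x i * k i),
    sum_triple_mul (fun i => x i * k i) (fun i => h i * y i) (fun i => x i * y i),
    sum_triple_mul (fun i => x i * y i) (fun i => h i * k i) (fun i => x i * y i),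
    sum_triple_mul (fun i => x i * y i) (fun i => h i * y i) (fun i => x i * k i),
    sum_triple_mul (fun i => x i * k i) (fun i => x i * y i) (fun i => h i * y i),
    sum_triple_mul (fun i => x i * y i) (fun i => x i * k i) (fun i => h i * y i),
    sum_triple_mul (fun i => x i * y i) (fun i => x i * y i) (fun i => h i * k i)]
  simp only [dotProduct]
  ring

theorem sum_slotGrad_dotProduct_slotGrad (x y : Fin d → ℝ) :
    ∑ t, slotGrad x t ⬝ᵥ slotGrad y t = (3 * d + 6) * (x ⬝ᵥ y) ^ 2 := by
  have h : ∀ t, slotGrad x t ⬝ᵥ slotGrad y t =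
      ∑ i, symSlot x (Pi.single i 1) t * symSlot y (Pi.single i 1) t := fun t => rfl
  have hxy : ∑ i, x i * y i = x ⬝ᵥ y := rfl
  simp only [h]
  rw [Finset.sum_comm]
  simp only [sum_symSlot_mul_symSlot, single_dotProduct, dotProduct_single, Pi.single_eq_same]
  have e : ∀ i, 3 * (1 * 1) * (x ⬝ᵥ y) ^ 2 + 6 * (1 * y i) * (x i * 1) * (x ⬝ᵥ y) =
      3 * (x ⬝ᵥ y) ^ 2 + 6 * (x ⬝ᵥ y) * (x i * y i) := fun i => by ring
  simp only [e, Finset.sum_add_distrib, ← Finset.mul_sum, hxy, Finset.sum_const, Finset.card_univ,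
    Fintype.card_fin, nsmul_eq_mul]
  ring

/-- The gradient is supported on the three indices of `t`. The factor 3 pays for coinciding indices,
whose contributions add up before squaring. -/
theorem slotGrad_sq_le (x : Fin d → ℝ) (t : Fin d × Fin d × Fin d) :
    slotGrad x t ⬝ᵥ slotGrad x t ≤ 3 * (x t.2.1 ^ 2 * x t.2.2 ^ 2 + x t.1 ^ 2 * x t.2.2 ^ 2 +
      x t.1 ^ 2 * x t.2.1 ^ 2) := by
  have h : ∀ i, slotGrad x t i * slotGrad x t i ≤
      3 * ((if i = t.1 then x t.2.1 ^ 2 * x t.2.2 ^ 2 else 0) +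
        (if i = t.2.1 then x t.1 ^ 2 * x t.2.2 ^ 2 else 0) +
        (if i = t.2.2 then x t.1 ^ 2 * x t.2.1 ^ 2 else 0)) := by
    intro i
    set p : ℝ := if i = t.1 then x t.2.1 * x t.2.2 else 0 with hp
    set q : ℝ := if i = t.2.1 then x t.1 * x t.2.2 else 0 with hq
    set s : ℝ := if i = t.2.2 then x t.1 * x t.2.1 else 0 with hs
    have e : slotGrad x t i = p + q + s := by
      simp only [slotGrad, symSlot, Pi.single_apply, hp, hq, hs, eq_comm (a := i)]
      split_ifs <;> ring
    have e1 : (if i = t.1 then x t.2.1 ^ 2 * x t.2.2 ^ 2 else 0) = p ^ 2 := by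
      rw [hp]; split_ifs <;> ring
    have e2 : (if i = t.2.1 then x t.1 ^ 2 * x t.2.2 ^ 2 else 0) = q ^ 2 := by
      rw [hq]; split_ifs <;> ring
    have e3 : (if i = t.2.2 then x t.1 ^ 2 * x t.2.1 ^ 2 else 0) = s ^ 2 := by
      rw [hs]; split_ifs <;> ring
    rw [e, e1, e2, e3]
    nlinarith [sq_nonneg (p - q), sq_nonneg (p - s), sq_nonneg (q - s)]
  refine (Finset.sum_le_sum fun i _ => h i).trans (le_of_eq ?_)
  rw [← Finset.mul_sum]
  simp [Finset.sum_add_distrib]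

theorem slotGrad_sq_le_of_sq_le {x : Fin d → ℝ} {γ : ℝ} (hx : ∀ i, x i ^ 2 ≤ γ)
    (t : Fin d × Fin d × Fin d) : slotGrad x t ⬝ᵥ slotGrad x t ≤ 9 * γ ^ 2 := by
  have h : ∀ i j, x i ^ 2 * x j ^ 2 ≤ γ * γ := fun i j =>
    mul_le_mul (hx i) (hx j) (sq_nonneg _) ((sq_nonneg _).trans (hx i))
  linarith [slotGrad_sq_le x t, h t.2.1 t.2.2, h t.1 t.2.2, h t.1 t.2.1]

/-- The only term with a free index is $x_a^4\le\gamma x_a^2$; its sum over $c$ costs $d\gamma$,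
negligible against the main term of order $d$ when $\gamma$ is small. -/
theorem sum_slotGrad_sq_diag_le {x : Fin d → ℝ} {γ : ℝ} (hx : ∀ i, x i ^ 2 ≤ γ)
    (hx1 : x ⬝ᵥ x = 1) :
    ∑ a, ∑ c, slotGrad x (a, a, c) ⬝ᵥ slotGrad x (a, a, c) ≤ 6 + 3 * d * γ := by
  have hsq : ∑ a, x a ^ 2 = 1 := by rw [← hx1, dotProduct]; exact Finset.sum_congr rfl fun _ _ => sq _
  have h : ∀ a c, slotGrad x (a, a, c) ⬝ᵥ slotGrad x (a, a, c) ≤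
      6 * (x a ^ 2 * x c ^ 2) + 3 * γ * x a ^ 2 := fun a c => by
    have := slotGrad_sq_le x (a, a, c)
    have := mul_le_mul_of_nonneg_right (hx a) (sq_nonneg (x a))
    simp only at *
    linarith
  refine (Finset.sum_le_sum fun a _ => Finset.sum_le_sum fun c _ => h a c).trans (le_of_eq ?_)
  simp only [Finset.sum_add_distrib, ← Finset.mul_sum, ← Finset.sum_mul, hsq, Finset.sum_const,
    Finset.card_univ, Fintype.card_fin, nsmul_eq_mul]
  ring

theorem dotProduct_sq_le (x y : Fin d → ℝ) : (x ⬝ᵥ y) ^ 2 ≤ (x ⬝ᵥ x) * (y ⬝ᵥ y) := by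
  simpa [dotProduct, sq] using Finset.sum_mul_sq_le_sq_mul_sq Finset.univ x y

end SymmetrizedSlot

/-! ### The approximate tangent projection: trace, Frobenius norm and row bounds. -/

section TensorProjection

variable {d r : ℕ}

/-- The squared norms of the rows of the matrix `(1/3) ∑ l, ⟨slotGrad (x l) t, slotGrad (x l) τ⟩`,
which approximates the orthogonal projection onto the tangent space of the CP tensors. -/
noncomputable def tangentWeight (x : Fin r → Fin d → ℝ) (t : Fin d × Fin d × Fin d) : ℝ :=
  ∑ τ, (1 / 3 * ∑ l, slotGrad (x l) t ⬝ᵥ slotGrad (x l) τ) ^ 2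

theorem tangentWeight_nonneg (x : Fin r → Fin d → ℝ) (t : Fin d × Fin d × Fin d) :
    0 ≤ tangentWeight x t :=
  Finset.sum_nonneg fun _ _ => sq_nonneg _

theorem tangentWeight_eq (x : Fin r → Fin d → ℝ) (t : Fin d × Fin d × Fin d) :
    tangentWeight x t = ∑ l, ∑ m, (1 / 3 * (slotGrad (x l) t ⬝ᵥ slotGrad (x m) t) *
      (x l ⬝ᵥ x m) ^ 2 + 2 / 3 * (symSlot (x l) (x m) t * symSlot (x m) (x l) t) *
        (x l ⬝ᵥ x m)) := by
  have h : ∀ τ, (1 / 3 * ∑ l, slotGrad (x l) t ⬝ᵥ slotGrad (x l) τ) ^ 2 =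
      ∑ l, ∑ m, 1 / 9 * (symSlot (x l) (slotGrad (x l) t) τ *
        symSlot (x m) (slotGrad (x m) t) τ) := fun τ => by
    simp only [← symSlot_eq_dotProduct]
    rw [mul_pow, sq (∑ l, _), Finset.sum_mul_sum, Finset.mul_sum]
    refine Finset.sum_congr rfl fun l _ => ?_
    rw [Finset.mul_sum]
    norm_num
  simp only [tangentWeight, h]
  rw [Finset.sum_comm]
  refine Finset.sum_congr rfl fun l _ => ?_
  rw [Finset.sum_comm]
  refine Finset.sum_congr rfl fun m _ => ?_
  rw [← Finset.mul_sum, sum_symSlot_mul_symSlot, symSlot_eq_dotProduct (x l) (x m),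
    symSlot_eq_dotProduct (x m) (x l), dotProduct_comm (slotGrad (x l) t) (x m)]
  ring

/-- This is the squared Frobenius norm of the approximate projection. The terms $l=m$ give $d+8$
each: eigenvalue 1 on the complement of $x_l$ and 3 along it. -/
theorem sum_tangentWeight {x : Fin r → Fin d → ℝ} (hx : ∀ l, x l ⬝ᵥ x l = 1) :
    ∑ t, tangentWeight x t =
      ∑ l, ∑ m, ((d + 4) * (x l ⬝ᵥ x m) ^ 4 + 4 * (x l ⬝ᵥ x m) ^ 2) := by
  simp only [tangentWeight_eq]
  rw [Finset.sum_comm]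
  refine Finset.sum_congr rfl fun l _ => ?_
  rw [Finset.sum_comm]
  refine Finset.sum_congr rfl fun m _ => ?_
  rw [Finset.sum_add_distrib, ← Finset.sum_mul, ← Finset.sum_mul, ← Finset.mul_sum,
    ← Finset.mul_sum, sum_slotGrad_dotProduct_slotGrad, sum_symSlot_mul_symSlot, hx, hx,
    dotProduct_comm (x m) (x l)]
  ring

theorem sum_trace_tangent {x : Fin r → Fin d → ℝ} (hx : ∀ l, x l ⬝ᵥ x l = 1) :
    ∑ t, 1 / 3 * ∑ l, slotGrad (x l) t ⬝ᵥ slotGrad (x l) t = r * (d + 2) := by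
  rw [← Finset.mul_sum, Finset.sum_comm]
  simp only [sum_slotGrad_dotProduct_slotGrad, hx]
  simp
  ring

/-- A Schur test: the $(l,m)$ term is at most $|\langle x_l,x_m\rangle|$ times the average of the
two squared gradients, and $r\beta\le1$ bounds the row sums of the absolute Gram matrix by 2. -/
theorem tangentWeight_le {x : Fin r → Fin d → ℝ} {β : ℝ} (hx : ∀ l, x l ⬝ᵥ x l = 1)
    (hβ0 : 0 ≤ β) (hβ : ∀ l m, l ≠ m → |x l ⬝ᵥ x m| ≤ β) (hrβ : r * β ≤ 1)
    (t : Fin d × Fin d × Fin d) :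
    tangentWeight x t ≤ 2 * ∑ l, slotGrad (x l) t ⬝ᵥ slotGrad (x l) t := by
  set G : Fin r → ℝ := fun l => slotGrad (x l) t ⬝ᵥ slotGrad (x l) t with hG
  have hG0 : ∀ l, 0 ≤ G l := fun l => Finset.sum_nonneg fun i _ => mul_self_nonneg _
  have hρ1 : ∀ l m, |x l ⬝ᵥ x m| ≤ 1 := fun l m => by
    have := dotProduct_sq_le (x l) (x m)
    rw [hx, hx, one_mul] at this
    exact (sq_le_one_iff_abs_le_one _).1 this
  have hterm : ∀ l m, 1 / 3 * (slotGrad (x l) t ⬝ᵥ slotGrad (x m) t) *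
      (x l ⬝ᵥ x m) ^ 2 + 2 / 3 * (symSlot (x l) (x m) t * symSlot (x m) (x l) t) *
        (x l ⬝ᵥ x m) ≤ |x l ⬝ᵥ x m| * ((G l + G m) / 2) := by
    intro l m
    set ρ := x l ⬝ᵥ x m
    have h1 : |slotGrad (x l) t ⬝ᵥ slotGrad (x m) t| ≤ (G l + G m) / 2 := by
      refine abs_le_of_sq_le_sq ?_ (by linarith [hG0 l, hG0 m])
      have := dotProduct_sq_le (slotGrad (x l) t) (slotGrad (x m) t)
      nlinarith [sq_nonneg (G l - G m)]
    have h2 : |symSlot (x l) (x m) t * symSlot (x m) (x l) t| ≤ (G l + G m) / 2 := by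
      have e1 := dotProduct_sq_le (x m) (slotGrad (x l) t)
      have e2 := dotProduct_sq_le (x l) (slotGrad (x m) t)
      rw [← symSlot_eq_dotProduct, hx, one_mul] at e1 e2
      rw [abs_le]
      constructor <;> nlinarith [sq_nonneg (symSlot (x l) (x m) t - symSlot (x m) (x l) t),
        sq_nonneg (symSlot (x l) (x m) t + symSlot (x m) (x l) t)]
    have hM : 0 ≤ (G l + G m) / 2 := by linarith [hG0 l, hG0 m]
    have h3 : (slotGrad (x l) t ⬝ᵥ slotGrad (x m) t) * ρ ^ 2 ≤ |ρ| * ((G l + G m) / 2) := by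
      refine (le_abs_self _).trans ?_
      rw [abs_mul, abs_pow, sq, mul_comm]
      refine mul_le_mul ?_ h1 (abs_nonneg _) (abs_nonneg _)
      exact mul_le_of_le_one_left (abs_nonneg _) (hρ1 l m)
    have h4 : (symSlot (x l) (x m) t * symSlot (x m) (x l) t) * ρ ≤ |ρ| * ((G l + G m) / 2) := by
      refine (le_abs_self _).trans ?_
      rw [abs_mul, mul_comm]
      exact mul_le_mul_of_nonneg_left h2 (abs_nonneg _)
    linarith
  have hrow : ∀ l, ∑ m, |x l ⬝ᵥ x m| ≤ 2 := fun l => by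
    calc ∑ m, |x l ⬝ᵥ x m| ≤ ∑ m, ((if l = m then 1 else 0) + β) := by
          refine Finset.sum_le_sum fun m _ => ?_
          split_ifs with h
          · linarith [hρ1 l m]
          · linarith [hβ l m h]
      _ = 1 + r * β := by simp [Finset.sum_add_distrib]
      _ ≤ 2 := by linarith
  rw [tangentWeight_eq]
  calc _ ≤ ∑ l, ∑ m, |x l ⬝ᵥ x m| * ((G l + G m) / 2) :=
        Finset.sum_le_sum fun l _ => Finset.sum_le_sum fun m _ => hterm l m
    _ = (∑ l, ∑ m, |x l ⬝ᵥ x m| * G l) / 2 + (∑ l, ∑ m, |x l ⬝ᵥ x m| * G m) / 2 := by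
        rw [Finset.sum_div, Finset.sum_div, ← Finset.sum_add_distrib]
        refine Finset.sum_congr rfl fun l _ => ?_
        rw [Finset.sum_div, Finset.sum_div, ← Finset.sum_add_distrib]
        exact Finset.sum_congr rfl fun m _ => by ring
    _ = ∑ l, ∑ m, |x l ⬝ᵥ x m| * G l := by
        have : ∑ l, ∑ m, |x l ⬝ᵥ x m| * G m = ∑ l, ∑ m, |x l ⬝ᵥ x m| * G l := by
          rw [Finset.sum_comm]
          simp only [dotProduct_comm]
        rw [this]
        ring
    _ ≤ ∑ l, 2 * G l := by
        refine Finset.sum_le_sum fun l _ => ?_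
        rw [← Finset.sum_mul]
        exact mul_le_mul_of_nonneg_right (hrow l) (hG0 l)
    _ = _ := by rw [Finset.mul_sum]

end TensorProjection

/-! ### Test directions and the two deterministic risk bounds. -/

section Directions

variable {d r : ℕ}

/-- The direction of the factor `U l`. -/
noncomputable def unitFactor (U : Factors d r) (l : Fin r) : Fin d → ℝ := fun i => U l i / ‖U l‖

theorem norm_smul_unitFactor {U : Factors d r} {l : Fin r} (h : U l ≠ 0) (i : Fin d) :
    ‖U l‖ * unitFactor U l i = U l i := by
  have := norm_ne_zero_iff.2 h
  rw [unitFactor]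
  field_simp

theorem unitFactor_dotProduct (U : Factors d r) (l m : Fin r) :
    unitFactor U l ⬝ᵥ unitFactor U m = inner ℝ (U l) (U m) / (‖U l‖ * ‖U m‖) := by
  simp only [dotProduct, unitFactor, PiLp.inner_apply, Finset.sum_div]
  refine Finset.sum_congr rfl fun i _ => ?_
  simp
  ring

theorem unitFactor_dotProduct_self {U : Factors d r} {l : Fin r} (h : U l ≠ 0) :
    unitFactor U l ⬝ᵥ unitFactor U l = 1 := by
  have := norm_ne_zero_iff.2 h
  rw [unitFactor_dotProduct, real_inner_self_eq_norm_sq]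
  field_simp

theorem cpDeriv_eq_sum_symSlot {U : Factors d r} (hU : ∀ l, U l ≠ 0) (H : Factors d r)
    (t : Fin d × Fin d × Fin d) :
    cpDeriv U H t.1 t.2.1 t.2.2 = ∑ l, ‖U l‖ ^ 2 * symSlot (unitFactor U l) (H l) t := by
  refine Finset.sum_congr rfl fun l _ => ?_
  simp only [← norm_smul_unitFactor (hU l), symSlot]
  ring

theorem sum_selectedWeight {ι α : Type*} [Fintype ι] [Fintype α] (w : α → ι → ℝ) (s : Set ι) :
    ∑ k, selectedWeight (w k) s = selectedWeight (fun i => ∑ k, w k i) s := by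
  simp only [selectedWeight]
  rw [Finset.sum_comm]
  refine Finset.sum_congr rfl fun i _ => ?_
  split_ifs <;> simp

theorem selectedWeight_const_mul {ι : Type*} [Fintype ι] (c : ℝ) (w : ι → ℝ) (s : Set ι) :
    selectedWeight (fun i => c * w i) s = c * selectedWeight w s := by
  simp only [selectedWeight, Finset.mul_sum]
  refine Finset.sum_congr rfl fun i _ => ?_
  split_ifs <;> simp

/-- The lower bound for the risk of a locally unbiased estimator of a single factor. -/
theorem factor_risk_ge {ω : Set (OrderedTriple d)} {U : Factors d r} {σ p η : ℝ} (hσ : 0 < σ)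
    (hp : 0 < p) (hU : ∀ l, U l ≠ 0) {l : Fin r}
    (hω : selectedWeight (fun t => slotGrad (unitFactor U l) t.1 ⬝ᵥ slotGrad (unitFactor U l) t.1) ω
      ≤ (1 + η) * p * d / 2)
    {uhat : Tensor d → EuclideanSpace ℝ (Fin d)}
    (hu : LocallyUnbiasedAt (symmSet ω) σ U (fun V => V l) uhat) :
    ENNReal.ofReal ((2 - 2 * η) * σ ^ 2 * d / (p * ‖U l‖ ^ 4)) ≤
      ∫⁻ y, ENNReal.ofReal (‖uhat y - U l‖ ^ 2) ∂(dataLaw (symmSet ω) σ U) := by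
  have hn : 0 < ‖U l‖ := norm_pos_iff.2 (hU l)
  set H : Fin d → Factors d r := fun i => Pi.single l (EuclideanSpace.single i 1) with hH
  -- The maximizer of $2cd-c^2\|u_l\|^4pd/(2\sigma^2)$, the bound at $\eta=0$.
  set c : ℝ := 2 * σ ^ 2 / (p * ‖U l‖ ^ 4) with hc
  have hD : ∀ k, HasDerivAt (fun s : ℝ => (EuclideanSpace.proj k : _ →L[ℝ] ℝ) ((U + s • H k) l))
      1 0 := fun k => by
    have := ((hasDerivAt_id (0 : ℝ)).mul_const (1 : ℝ)).const_add (U l k)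
    simpa [hH] using this
  have hderiv : ∀ k t, cpDeriv U (H k) t.1 t.2.1 t.2.2 =
      ‖U l‖ ^ 2 * slotGrad (unitFactor U l) t k := fun k t => by
    rw [cpDeriv_eq_sum_symSlot hU, Finset.sum_eq_single l]
    · simp only [slotGrad, symSlot, hH, Pi.single_eq_same, PiLp.single_apply, Pi.single_apply]
    · intro m _ hm
      simp [symSlot, hH, Pi.single_eq_of_ne hm]
    · simp
  have hweight : ∑ k, selectedWeight (fun t : OrderedTriple d =>
      cpDeriv U (H k) t.1.1 t.1.2.1 t.1.2.2 ^ 2) ω = ‖U l‖ ^ 4 * selectedWeight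
        (fun t => slotGrad (unitFactor U l) t.1 ⬝ᵥ slotGrad (unitFactor U l) t.1) ω := by
    rw [sum_selectedWeight, ← selectedWeight_const_mul]
    congr 1
    ext t
    rw [dotProduct, Finset.mul_sum]
    refine Finset.sum_congr rfl fun k _ => ?_
    rw [hderiv]
    ring
  have h := hu.risk_ge hσ (fun k => EuclideanSpace.proj k) H (fun _ => 1) hD c
  rw [hweight] at h
  refine (ENNReal.ofReal_le_ofReal ?_).trans (h.trans (le_of_eq ?_))
  · have h1 : c ^ 2 * (‖U l‖ ^ 4 * selectedWeight
        (fun t => slotGrad (unitFactor U l) t.1 ⬝ᵥ slotGrad (unitFactor U l) t.1) ω / σ ^ 2) ≤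
        c ^ 2 * (‖U l‖ ^ 4 * ((1 + η) * p * d / 2) / σ ^ 2) := by gcongr
    have h2 : (2 - 2 * η) * σ ^ 2 * d / (p * ‖U l‖ ^ 4) =
        2 * c * d - c ^ 2 * (‖U l‖ ^ 4 * ((1 + η) * p * d / 2) / σ ^ 2) := by
      rw [hc]
      field_simp
      ring
    rw [h2]
    simp only [Finset.sum_const, Finset.card_univ, Fintype.card_fin, nsmul_eq_mul, mul_one]
    linarith
  · congr 1
    ext y
    rw [EuclideanSpace.norm_sq_eq]
    simp

/-- The lower bound for the risk of a locally unbiased estimator of the tensor. -/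
theorem tensor_risk_ge {ω : Set (OrderedTriple d)} {U : Factors d r} {σ p η : ℝ} (hσ : 0 < σ)
    (hp : 0 < p) (hU : ∀ l, U l ≠ 0)
    (hω : selectedWeight (fun t => tangentWeight (unitFactor U) t.1) ω ≤ (1 + η) * p * (r * d) / 6)
    {That : Tensor d → Tensor d} (hT : LocallyUnbiasedAt (symmSet ω) σ U cpTensor That) :
    ENNReal.ofReal ((6 - 6 * η) * σ ^ 2 * d * r / p) ≤
      ∫⁻ y, ENNReal.ofReal (frobSq (That y - cpTensor U)) ∂(dataLaw (symmSet ω) σ U) := by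
  set x := unitFactor U with hx
  -- The factor $\|u_l\|^{-2}$ cancels the scale of the derivative in slot $l$, and $1/3$ inverts
  -- the main part of the Gram form, so the derivative along `H τ` is column `τ` of the approximate
  -- projection.
  set H : Fin d × Fin d × Fin d → Factors d r := fun τ l =>
    (3 * ‖U l‖ ^ 2)⁻¹ • WithLp.toLp 2 (slotGrad (x l) τ) with hH
  set φ : Fin d × Fin d × Fin d → Tensor d →L[ℝ] ℝ := fun τ =>
    (ContinuousLinearMap.proj τ.2.2 : (Fin d → ℝ) →L[ℝ] ℝ).comp
      ((ContinuousLinearMap.proj τ.2.1 : (Fin d → Fin d → ℝ) →L[ℝ] (Fin d → ℝ)).comp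
        (ContinuousLinearMap.proj τ.1)) with hφ
  -- The maximizer of $2crd-c^2prd/(6\sigma^2)$; the surplus $2r$ in the trace is discarded in `h3`.
  set c : ℝ := 6 * σ ^ 2 / p with hc
  have hderiv : ∀ τ t, cpDeriv U (H τ) t.1 t.2.1 t.2.2 =
      1 / 3 * ∑ l, slotGrad (x l) t ⬝ᵥ slotGrad (x l) τ := fun τ t => by
    rw [cpDeriv_eq_sum_symSlot hU, Finset.mul_sum]
    refine Finset.sum_congr rfl fun l _ => ?_
    have hn : ‖U l‖ ≠ 0 := norm_ne_zero_iff.2 (hU l)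
    have : ((H τ l : EuclideanSpace ℝ (Fin d)) : Fin d → ℝ) =
        (3 * ‖U l‖ ^ 2)⁻¹ • slotGrad (x l) τ := rfl
    rw [this, symSlot_smul_right, symSlot_eq_dotProduct, dotProduct_comm,
      ← hx]
    field_simp
  have hD : ∀ τ, HasDerivAt (fun s : ℝ => φ τ (cpTensor (U + s • H τ)))
      (1 / 3 * ∑ l, slotGrad (x l) τ ⬝ᵥ slotGrad (x l) τ) 0 := fun τ => by
    rw [← hderiv τ τ]
    exact hasDerivAt_cpTensor U (H τ) τ.1 τ.2.1 τ.2.2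
  have hweight : ∑ τ, selectedWeight (fun t : OrderedTriple d =>
      cpDeriv U (H τ) t.1.1 t.1.2.1 t.1.2.2 ^ 2) ω =
        selectedWeight (fun t => tangentWeight x t.1) ω := by
    rw [sum_selectedWeight]
    congr 1
    ext t
    exact Finset.sum_congr rfl fun τ _ => by rw [hderiv]
  have h := hT.risk_ge hσ φ H _ hD c
  rw [hweight, sum_trace_tangent fun l => unitFactor_dotProduct_self (hU l)] at h
  refine (ENNReal.ofReal_le_ofReal ?_).trans (h.trans (le_of_eq ?_))
  · have h1 : c ^ 2 * (selectedWeight (fun t => tangentWeight x t.1) ω / σ ^ 2) ≤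
        c ^ 2 * (((1 + η) * p * (r * d) / 6) / σ ^ 2) := by gcongr
    have h2 : (6 - 6 * η) * σ ^ 2 * d * r / p =
        2 * c * (r * d) - c ^ 2 * (((1 + η) * p * (r * d) / 6) / σ ^ 2) := by
      rw [hc]
      field_simp
      ring
    have h3 : 2 * c * (r * d) ≤ 2 * c * (r * (d + 2)) := by
      have : 0 ≤ c := by positivity
      gcongr
      linarith
    rw [h2]
    linarith
  · congr 1
    ext y
    simp only [Fintype.sum_prod_type, frobSq]
    rfl

end Directions

/-! ### Expected information, up to a relative error of order $\gamma$. -/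

section Totals

variable {d r : ℕ}

theorem sum_orderedTriple_slotGrad_sq_le {x : Fin d → ℝ} {γ : ℝ} (hx : ∀ i, x i ^ 2 ≤ γ)
    (hx1 : x ⬝ᵥ x = 1) (hdγ : 1 ≤ d * γ) :
    ∑ t : OrderedTriple d, slotGrad x t.1 ⬝ᵥ slotGrad x t.1 ≤ d / 2 * (1 + 300 * γ) := by
  have h := sum_orderedTriple_le (f := fun a b c => slotGrad x (a, b, c) ⬝ᵥ slotGrad x (a, b, c))
    (fun a b c => Finset.sum_nonneg fun i _ => mul_self_nonneg _)
    (fun a b c => by rw [slotGrad_swap_left]) (fun a b c => by rw [slotGrad_swap_right])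
  have h1 := sum_slotGrad_dotProduct_slotGrad x x
  rw [hx1] at h1
  simp only [Fintype.sum_prod_type] at h1
  rw [h1] at h
  refine h.trans ?_
  have := sum_slotGrad_sq_diag_le hx hx1
  linarith

theorem sum_orderedTriple_tangentWeight_le {x : Fin r → Fin d → ℝ} {γ : ℝ}
    (hx : ∀ l i, x l i ^ 2 ≤ γ) (hx1 : ∀ l, x l ⬝ᵥ x l = 1) (hdγ : 1 ≤ d * γ) (hγ : 0 ≤ γ)
    (hinner : ∀ l m, l ≠ m → (x l ⬝ᵥ x m) ^ 2 ≤ γ) (hr : r ^ 2 * γ ≤ 1)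
    (hw : ∀ t, tangentWeight x t ≤ 2 * ∑ l, slotGrad (x l) t ⬝ᵥ slotGrad (x l) t) :
    ∑ t : OrderedTriple d, tangentWeight x t.1 ≤ r * d / 6 * (1 + 300 * γ) := by
  have hswapL : ∀ a b c, tangentWeight x (a, b, c) = tangentWeight x (b, a, c) := fun a b c => by
    simp only [tangentWeight, slotGrad_swap_left _ a b c]
  have hswapR : ∀ a b c, tangentWeight x (a, b, c) = tangentWeight x (a, c, b) := fun a b c => by
    simp only [tangentWeight, slotGrad_swap_right _ a b c]
  have h := sum_orderedTriple_le (f := fun a b c => tangentWeight x (a, b, c))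
    (fun a b c => tangentWeight_nonneg x _) hswapL hswapR
  have hall : ∑ t, tangentWeight x t ≤ r * d * (1 + 17 * γ) := by
    rcases Nat.eq_zero_or_pos r with rfl | hr0
    · simp [tangentWeight]
    have hr1 : (1 : ℝ) ≤ r := by exact_mod_cast hr0
    have hd0 : (0 : ℝ) ≤ d := Nat.cast_nonneg d
    have hγ1 : γ ≤ 1 := (le_mul_of_one_le_left hγ (one_le_pow₀ hr1)).trans hr
    rw [sum_tangentWeight hx1]
    calc ∑ l, ∑ m, ((d + 4) * (x l ⬝ᵥ x m) ^ 4 + 4 * (x l ⬝ᵥ x m) ^ 2)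
        ≤ ∑ l : Fin r, ∑ m : Fin r, ((if l = m then (d + 8 : ℝ) else 0) +
            ((d + 4) * γ ^ 2 + 4 * γ)) := by
          refine Finset.sum_le_sum fun l _ => Finset.sum_le_sum fun m _ => ?_
          split_ifs with hlm
          · rw [← hlm, hx1]
            have : 0 ≤ (d + 4) * γ ^ 2 + 4 * γ := by positivity
            linarith
          · have h1 := hinner l m hlm
            have h2 : (x l ⬝ᵥ x m) ^ 4 ≤ γ ^ 2 := by
              have := pow_le_pow_left₀ (sq_nonneg _) h1 2
              rwa [← pow_mul] at this
            have := mul_le_mul_of_nonneg_left h2 (by positivity : (0 : ℝ) ≤ d + 4)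
            linarith
      _ = r * (d + 8) + r ^ 2 * γ * ((d + 4) * γ + 4) := by
          simp [Finset.sum_add_distrib]
          ring
      _ ≤ r * (d + 8) + 1 * ((d + 4) * γ + 4) := by gcongr
      _ ≤ r * (d + 8) + r * ((d + 4) * γ + 4) := by gcongr
      -- Additive constants are absorbed through $1\le d\gamma$: $17=8+1+4+4$.
      _ ≤ r * (d * (1 + 17 * γ)) := by
          rw [← mul_add]
          have : γ ≤ d * γ := hγ1.trans hdγ
          gcongr
          linarith
      _ = _ := by ring
  have hdiag : ∑ a, ∑ c, tangentWeight x (a, a, c) ≤ 2 * (r * (6 + 3 * d * γ)) := by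
    calc ∑ a, ∑ c, tangentWeight x (a, a, c)
        ≤ ∑ a, ∑ c, 2 * ∑ l, slotGrad (x l) (a, a, c) ⬝ᵥ slotGrad (x l) (a, a, c) :=
          Finset.sum_le_sum fun a _ => Finset.sum_le_sum fun c _ => hw _
      _ = 2 * ∑ l, ∑ a, ∑ c, slotGrad (x l) (a, a, c) ⬝ᵥ slotGrad (x l) (a, a, c) := by
          simp only [← Finset.mul_sum]
          congr 1
          rw [Finset.sum_comm (s := (Finset.univ : Finset (Fin r)))]
          exact Finset.sum_congr rfl fun a _ => Finset.sum_comm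
      _ ≤ 2 * ∑ _l : Fin r, (6 + 3 * d * γ) := by
          gcongr with l
          exact sum_slotGrad_sq_diag_le (hx l) (hx1 l)
      _ = _ := by simp [mul_add]
  simp only [Fintype.sum_prod_type] at hall
  refine h.trans ?_
  have hr0 : (0 : ℝ) ≤ r := Nat.cast_nonneg r
  have := mul_le_mul_of_nonneg_left hdγ hr0
  have h0 : 0 ≤ r * (d * γ) := by positivity
  linarith

end Totals

/-! ### From incoherence to the probability of the risk bounds. -/

section Incoherence

variable {d r : ℕ} {U : Factors d r} {μ₀ μ₁ μ₂ : ℝ}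

theorem Incoherent.unitFactor_sq_le (h : Incoherent U μ₀ μ₁ μ₂) (hU : ∀ l, U l ≠ 0) (l : Fin r)
    (i : Fin d) : unitFactor U l i ^ 2 ≤ √(μ₁ / d) ^ 2 := by
  have hn : 0 < ‖U l‖ := norm_pos_iff.2 (hU l)
  refine sq_le_sq' ?_ ?_
  · rw [unitFactor, le_div_iff₀ hn]
    linarith [(abs_le.1 (h.factor l i)).1]
  · rw [unitFactor, div_le_iff₀ hn]
    exact (abs_le.1 (h.factor l i)).2

/-- A unit vector in $\mathbb R^d$ has a squared coordinate of size at least $1/d$. This gives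
$d\gamma\ge1$, by which bounded errors are absorbed. -/
theorem Incoherent.one_le (h : Incoherent U μ₀ μ₁ μ₂) (hU : ∀ l, U l ≠ 0) (hr : 0 < r) :
    1 ≤ μ₁ := by
  have l : Fin r := ⟨0, hr⟩
  have h1 : (1 : ℝ) ≤ d * √(μ₁ / d) ^ 2 := by
    calc (1 : ℝ) = ∑ i, unitFactor U l i ^ 2 := by
          rw [← unitFactor_dotProduct_self (hU l), dotProduct]
          exact Finset.sum_congr rfl fun _ _ => (sq _).symm
      _ ≤ ∑ _i : Fin d, √(μ₁ / d) ^ 2 := Finset.sum_le_sum fun i _ => h.unitFactor_sq_le hU l i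
      _ = _ := by simp
  -- The nonpositive case covers $\mu_1\le0$ as well as $d=0$, where the quotient is 0 by
  -- convention.
  rcases le_or_gt (μ₁ / d) 0 with h0 | h0
  · rw [Real.sqrt_eq_zero_of_nonpos h0] at h1
    norm_num at h1
  · rw [Real.sq_sqrt h0.le] at h1
    have hd : (d : ℝ) ≠ 0 := by
      rintro hd
      rw [hd, div_zero] at h0
      exact lt_irrefl _ h0
    rwa [mul_div_cancel₀ _ hd] at h1

theorem Incoherent.abs_unitFactor_dotProduct_le (h : Incoherent U μ₀ μ₁ μ₂) (hU : ∀ l, U l ≠ 0)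
    {l m : Fin r} (hlm : l ≠ m) : |unitFactor U l ⬝ᵥ unitFactor U m| ≤ √(μ₂ / d) := by
  have hl : 0 < ‖U l‖ := norm_pos_iff.2 (hU l)
  have hm : 0 < ‖U m‖ := norm_pos_iff.2 (hU m)
  rw [unitFactor_dotProduct, abs_div, abs_of_pos (mul_pos hl hm), div_le_iff₀ (mul_pos hl hm),
    ← mul_assoc]
  exact h.inner l m hlm

/-- The probability that both risk bounds hold, in terms of the rank and the dimension. -/
theorem Incoherent.le_samplingLaw_riskLowerBounds (h : Incoherent U μ₀ μ₁ μ₂)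
    (hU : ∀ l, U l ≠ 0) (hr : 0 < r) {p : unitInterval} {σ μ q : ℝ} (hp : 0 < (p : ℝ))
    (hσ : 0 < σ) (hμ : μ = max μ₀ (max μ₁ μ₂)) (hlog : 1 ≤ Real.log d)
    (hγlog : μ / d ≤ 1 / Real.log d) (hrγ : r ^ 2 * (μ / d) ≤ 1)
    (hpq : q * (μ ^ 2 * Real.log d ^ 2 / d ^ 2) ≤ p) :
    1 - (r + 1) * Real.exp (-(q * d / 432)) ≤
      (samplingLaw d p).real {ω | RiskLowerBounds (symmSet ω) U p σ (3606 / Real.log d)} := by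
  have hr0 : (0 : ℝ) < r := by exact_mod_cast hr
  have hd : (0 : ℝ) < d := by
    rcases Nat.eq_zero_or_pos d with rfl | hd
    · norm_num at hlog
    · exact_mod_cast hd
  have hlog0 : 0 < Real.log d := one_pos.trans_le hlog
  have hμ1 : 1 ≤ μ := (h.one_le hU hr).trans (by simp [hμ])
  set γ := μ / d with hγdef
  have hγ : 0 < γ := by positivity
  have hdγ : 1 ≤ d * γ := by rwa [hγdef, mul_div_cancel₀ _ hd.ne']
  set δ := 1 / Real.log d with hδdef
  have hδ0 : 0 < δ := by positivity
  have hδ1 : δ ≤ 1 := by rw [hδdef, div_le_one hlog0]; exact hlog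
  set x := unitFactor U with hxdef
  have hx1 : ∀ l, x l ⬝ᵥ x l = 1 := fun l => unitFactor_dotProduct_self (hU l)
  have hx : ∀ l i, x l i ^ 2 ≤ γ := fun l i => by
    refine (h.unitFactor_sq_le hU l i).trans ?_
    rw [Real.sq_sqrt (div_nonneg (zero_le_one.trans (h.one_le hU hr)) hd.le)]
    exact div_le_div_of_nonneg_right (by simp [hμ]) hd.le
  have hρ : ∀ l m, l ≠ m → |x l ⬝ᵥ x m| ≤ √γ := fun l m hlm =>
    (h.abs_unitFactor_dotProduct_le hU hlm).trans
      (Real.sqrt_le_sqrt (div_le_div_of_nonneg_right (by simp [hμ]) hd.le))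
  have hρ2 : ∀ l m, l ≠ m → (x l ⬝ᵥ x m) ^ 2 ≤ γ := fun l m hlm => by
    have := pow_le_pow_left₀ (abs_nonneg _) (hρ l m hlm) 2
    rwa [sq_abs, Real.sq_sqrt hγ.le] at this
  have hrβ : r * √γ ≤ 1 := by
    rw [← abs_of_nonneg (by positivity : 0 ≤ r * √γ), ← sq_le_one_iff_abs_le_one, mul_pow,
      Real.sq_sqrt hγ.le]
    exact hrγ
  have htan : ∀ t, tangentWeight x t ≤ 2 * ∑ l, slotGrad (x l) t ⬝ᵥ slotGrad (x l) t :=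
    tangentWeight_le hx1 (Real.sqrt_nonneg _) hρ hrβ
  -- With $\delta=1/\log d$ and $\gamma=\mu/d$, the assumed sampling rate cancels $\mu^2\log^2d$
  -- exactly. The constant is that of the tensor, $432=6\cdot4\cdot18$, where the rank cancels
  -- between total and maximal weight.
  have hexp : q * d / 432 ≤ δ ^ 2 * p * d / (432 * γ ^ 2) := by
    have e : δ ^ 2 * (q * (μ ^ 2 * Real.log d ^ 2 / d ^ 2)) * d / (432 * γ ^ 2) = q * d / 432 := by
      have : μ ≠ 0 := by positivity
      rw [hδdef, hγdef]
      field_simp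
    rw [← e]
    gcongr
  set badF : Fin r → Set (Set (OrderedTriple d)) := fun l =>
    {ω | (1 + δ) * (p * (d / 2 * (1 + 300 * γ))) ≤
      selectedWeight (fun t => slotGrad (x l) t.1 ⬝ᵥ slotGrad (x l) t.1) ω} with hbadF
  set badT : Set (Set (OrderedTriple d)) :=
    {ω | (1 + δ) * (p * (r * d / 6 * (1 + 300 * γ))) ≤
      selectedWeight (fun t => tangentWeight x t.1) ω} with hbadT
  have hPF : ∀ l, (samplingLaw d p).real (badF l) ≤ Real.exp (-(q * d / 432)) := fun l => by
    refine (setBernoulli_real_selectedWeight_ge_le (m := 9 * γ ^ 2) p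
      (w := fun t : OrderedTriple d => slotGrad (x l) t.1 ⬝ᵥ slotGrad (x l) t.1)
      (fun t => Finset.sum_nonneg fun i _ => mul_self_nonneg _)
      (fun t => slotGrad_sq_le_of_sq_le (hx l) t.1) (by positivity)
      (sum_orderedTriple_slotGrad_sq_le (hx l) (hx1 l) hdγ) hδ0.le (by linarith)).trans ?_
    rw [Real.exp_le_exp, neg_le_neg_iff]
    refine hexp.trans ?_
    rw [div_le_div_iff₀ (by positivity) (by positivity)]
    have h1 : 0 ≤ δ ^ 2 * p * d * γ ^ 2 := by positivity
    have h2 : 0 ≤ δ ^ 2 * p * d * γ ^ 2 * γ := by positivity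
    nlinarith
  have hPT : (samplingLaw d p).real badT ≤ Real.exp (-(q * d / 432)) := by
    refine (setBernoulli_real_selectedWeight_ge_le (m := 18 * r * γ ^ 2) p
      (w := fun t : OrderedTriple d => tangentWeight x t.1)
      (fun t => tangentWeight_nonneg x t.1) (fun t => (htan t.1).trans ?_)
      (by positivity) (sum_orderedTriple_tangentWeight_le hx hx1 hdγ hγ.le hρ2 hrγ htan)
      hδ0.le (by linarith)).trans ?_
    · have : ∑ l, slotGrad (x l) t.1 ⬝ᵥ slotGrad (x l) t.1 ≤ ∑ _l : Fin r, 9 * γ ^ 2 :=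
        Finset.sum_le_sum fun l _ => slotGrad_sq_le_of_sq_le (hx l) t.1
      simp only [Finset.sum_const, Finset.card_univ, Fintype.card_fin, nsmul_eq_mul] at this
      linarith
    · rw [Real.exp_le_exp, neg_le_neg_iff]
      refine hexp.trans ?_
      rw [div_le_div_iff₀ (by positivity) (by positivity)]
      have h2 : 0 ≤ δ ^ 2 * p * d * γ ^ 2 * γ * r := by positivity
      nlinarith
  -- Uses $\gamma\le\delta\le1$; the slack $3606=6\cdot601$ then serves both bounds.
  have hη : (1 + δ) * (1 + 300 * γ) ≤ 1 + 601 * δ := by nlinarith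
  have hgood : Set.univ ⊆ {ω | RiskLowerBounds (symmSet ω) U p σ (3606 / Real.log d)} ∪
      (badT ∪ ⋃ l, badF l) := by
    intro ω _
    by_cases hT : ω ∈ badT
    · exact Or.inr (Or.inl hT)
    by_cases hF : ω ∈ ⋃ l, badF l
    · exact Or.inr (Or.inr hF)
    refine Or.inl ⟨fun l uhat hu => ?_, fun That hThat => ?_⟩
    · have hl : ω ∉ badF l := fun hl => hF (Set.mem_iUnion.2 ⟨l, hl⟩)
      refine le_trans (ENNReal.ofReal_le_ofReal ?_)
        (factor_risk_ge (η := 601 * δ) hσ hp hU ?_ hu)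
      · have : (3606 : ℝ) / Real.log d = 3606 * δ := by rw [hδdef]; ring
        rw [this]
        refine div_le_div_of_nonneg_right ?_ (by positivity)
        rw [mul_assoc, mul_assoc]
        exact mul_le_mul_of_nonneg_right (by linarith) (by positivity)
      · refine (not_le.1 hl).le.trans ?_
        have := mul_le_mul_of_nonneg_right hη (by positivity : 0 ≤ p * (d : ℝ) / 2)
        linarith
    · refine le_trans (le_of_eq ?_) (tensor_risk_ge (η := 601 * δ) hσ hp hU ?_ hThat)
      · rw [hδdef]
        congr 4
        ring
      · refine (not_le.1 hT).le.trans ?_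
        have := mul_le_mul_of_nonneg_right hη (by positivity : 0 ≤ (p : ℝ) * ((r : ℝ) * d) / 6)
        linarith
  have : IsProbabilityMeasure (samplingLaw d p) := by unfold samplingLaw; infer_instance
  have h1 : (1 : ℝ) ≤ (samplingLaw d p).real ({ω | RiskLowerBounds (symmSet ω) U p σ
      (3606 / Real.log d)} ∪ (badT ∪ ⋃ l, badF l)) := by
    rw [← probReal_univ (μ := samplingLaw d p)]
    exact measureReal_mono hgood
  have h2 := measureReal_union_le (μ := samplingLaw d p) {ω | RiskLowerBounds (symmSet ω) U p σ
      (3606 / Real.log d)} (badT ∪ ⋃ l, badF l)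
  have h3 := measureReal_union_le (μ := samplingLaw d p) badT (⋃ l, badF l)
  have h4 : (samplingLaw d p).real (⋃ l, badF l) ≤ r * Real.exp (-(q * d / 432)) := by
    refine (measureReal_iUnion_fintype_le _).trans ((Finset.sum_le_sum fun l _ => hPF l).trans ?_)
    simp
  linarith

end Incoherence

/-! ### Asymptotic estimates in the dimension. -/

section Asymptotics

theorem eventually_mul_exp_neg_le {b : ℝ} (hb : 0 < b) :
    ∀ᶠ d : ℕ in atTop, ((d : ℝ) + 1) * Real.exp (-(b * d)) ≤ 1 / (d : ℝ) ^ 10 := by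
  have h := ((isLittleO_pow_exp_pos_mul_atTop 11 hb).comp_tendsto
    (tendsto_natCast_atTop_atTop (R := ℝ))).bound (by norm_num : (0 : ℝ) < 1 / 2)
  filter_upwards [h, eventually_ge_atTop 1] with d hd h1
  have h1' : (1 : ℝ) ≤ d := by exact_mod_cast h1
  simp only [Function.comp_apply, norm_pow, Real.norm_eq_abs, Real.abs_exp, Nat.abs_cast] at hd
  rw [le_div_iff₀ (by positivity), Real.exp_neg, mul_assoc, inv_mul_eq_div, ← mul_div_assoc,
    div_le_one (Real.exp_pos _)]
  have : (d : ℝ) ^ 10 ≤ d * d ^ 10 := le_mul_of_one_le_left (by positivity) h1'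
  have e : (d : ℝ) ^ 11 = d * d ^ 10 := by ring
  linarith

theorem tendsto_const_div_log_natCast (c : ℝ) :
    Tendsto (fun d : ℕ => c / Real.log d) atTop (𝓝 0) :=
  (Real.tendsto_log_atTop.comp tendsto_natCast_atTop_atTop).const_div_atTop c

/-- Bounds the $r+1$ events of the union bound by $d+1$, so that the failure probability depends on
$d$ alone. -/
theorem natCast_le_of_sq_mul_div_le {d r : ℕ} {μ : ℝ} (hμ : 1 ≤ μ) (hd : 0 < d)
    (h : (r : ℝ) ^ 2 * (μ / d) ≤ 1) : (r : ℝ) ≤ d := by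
  have hd' : (0 : ℝ) < d := by exact_mod_cast hd
  rw [← mul_div_assoc, div_le_one hd'] at h
  have h1 : (r : ℝ) ^ 2 ≤ d := by nlinarith [sq_nonneg (r : ℝ)]
  have h2 : r ≤ r ^ 2 := Nat.le_self_pow two_ne_zero r
  have h3 : (r : ℝ) ≤ (r : ℝ) ^ 2 := by exact_mod_cast h2
  linarith

end Asymptotics

end TensorCompletion

open TensorCompletion in
theorem theorem7 :
    -- the case of bounded rank, incoherence and condition number
    (∀ R M K : ℝ, ∃ c₆ : ℝ, 0 < c₆ ∧ ∃ (C : ℝ) (ε : ℕ → ℝ), Tendsto ε atTop (𝓝 0) ∧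
      ∀ (d r : ℕ) (U : Factors d r) (μ₀ μ₁ μ₂ : ℝ) (p : unitInterval) (σ : ℝ),
        0 < r → (∀ l, U l ≠ 0) → Incoherent U μ₀ μ₁ μ₂ → 0 < (p : ℝ) → 0 < σ →
        (r : ℝ) ≤ R → max μ₀ (max μ₁ μ₂) ≤ M → condNumber U ≤ K →
        c₆ * (Real.log d ^ 2 / (d : ℝ) ^ 2) ≤ p →
        1 - C / (d : ℝ) ^ 10 ≤
          (samplingLaw d p).real {ω | RiskLowerBounds (symmSet ω) U p σ (ε d)}) ∧
    -- the general case, in which the rank and the incoherence may grow with the dimension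
    (∀ K : ℝ, ∃ c₆ c₇ : ℝ, 0 < c₆ ∧ 0 < c₇ ∧ ∃ (C : ℝ) (ε : ℕ → ℝ), Tendsto ε atTop (𝓝 0) ∧
      ∀ (d r : ℕ) (U : Factors d r) (μ₀ μ₁ μ₂ μ : ℝ) (p : unitInterval) (σ : ℝ),
        0 < r → (∀ l, U l ≠ 0) → Incoherent U μ₀ μ₁ μ₂ → μ = max μ₀ (max μ₁ μ₂) →
        0 < (p : ℝ) → 0 < σ → condNumber U ≤ K →
        c₆ * (μ ^ 2 * r * Real.log d ^ 2 / (d : ℝ) ^ 2) ≤ p →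
        (r : ℝ) ≤ c₇ * √(d / (μ * Real.log d)) →
        1 - C / (d : ℝ) ^ 10 ≤
          (samplingLaw d p).real {ω | RiskLowerBounds (symmSet ω) U p σ (ε d)}) := by
  have hpos : ∀ {d r : ℕ} {U : Factors d r}, 0 < r → (∀ l, U l ≠ 0) → 0 < d := by
    intro d r U hr hU
    rcases Nat.eq_zero_or_pos d with rfl | hd
    · exact absurd (Subsingleton.elim _ _) (hU ⟨0, hr⟩)
    · exact hd
  have hlog : ∀ᶠ d : ℕ in atTop, 1 ≤ Real.log d :=
    (Real.tendsto_log_atTop.comp tendsto_natCast_atTop_atTop).eventually_ge_atTop 1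
  -- The bound is trivial in small dimensions, by the choice of the constant.
  have hsmall : ∀ {N d : ℕ} {x : ℝ}, 0 < d → d < N → 0 ≤ x →
      1 - ((N : ℝ) + 1) ^ 10 / (d : ℝ) ^ 10 ≤ x := by
    intro N d x hd hN hx
    have hd' : (0 : ℝ) < d := by exact_mod_cast hd
    have hN' : (d : ℝ) ≤ N + 1 := by exact_mod_cast (by omega : d ≤ N + 1)
    have : 1 ≤ ((N : ℝ) + 1) ^ 10 / (d : ℝ) ^ 10 := by
      rw [one_le_div (by positivity)]
      gcongr
    linarith
  have hlarge : ∀ {N d r : ℕ} {b x : ℝ}, 0 < d → (r : ℝ) ≤ d →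
      ((d : ℝ) + 1) * Real.exp (-(b * d)) ≤ 1 / (d : ℝ) ^ 10 →
      1 - ((r : ℝ) + 1) * Real.exp (-(b * d)) ≤ x →
      1 - ((N : ℝ) + 1) ^ 10 / (d : ℝ) ^ 10 ≤ x := by
    intro N d r b x hd hrd he hx
    have hd' : (0 : ℝ) < d := by exact_mod_cast hd
    have h1 : ((r : ℝ) + 1) * Real.exp (-(b * d)) ≤ ((d : ℝ) + 1) * Real.exp (-(b * d)) := by
      gcongr
    have h2 : 1 / (d : ℝ) ^ 10 ≤ ((N : ℝ) + 1) ^ 10 / (d : ℝ) ^ 10 := by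
      gcongr
      exact one_le_pow₀ (by linarith [Nat.cast_nonneg (α := ℝ) N])
    linarith
  refine ⟨fun R M K => ?_, fun K => ?_⟩
  -- The maximum with 1 keeps $1/M'^2$ meaningful for every real `M`; that number becomes the rate
  -- `q`.
  · set M' := max M 1 with hM'
    have hM1 : 1 ≤ M' := le_max_right _ _
    have hMd : ∀ᶠ d : ℕ in atTop, M' / d ≤ 1 / Real.log d := by
      have h := (Real.isLittleO_log_id_atTop.comp_tendsto
        (tendsto_natCast_atTop_atTop (R := ℝ))).bound (by positivity : 0 < 1 / M')
      filter_upwards [h, hlog, eventually_gt_atTop 0] with d hd h1 h0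
      have h0' : (0 : ℝ) < d := by exact_mod_cast h0
      have h1' := one_pos.trans_le h1
      simp only [Function.comp_apply, id, Real.norm_natCast, Real.norm_of_nonneg h1'.le] at hd
      rw [div_le_div_iff₀ h0' h1']
      rw [one_div, inv_mul_eq_div, le_div_iff₀ (by positivity)] at hd
      linarith
    have hRd : ∀ᶠ d : ℕ in atTop, R ^ 2 * M' ≤ d :=
      tendsto_natCast_atTop_atTop.eventually_ge_atTop _
    have hb : 0 < 1 / M' ^ 2 / 432 := by positivity
    obtain ⟨N, hN⟩ := eventually_atTop.1 (hlog.and (hMd.and (hRd.and (eventually_mul_exp_neg_le hb))))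
    -- The constant $(N+1)^{10}$ makes the claim vacuous for $d<N$ and is at least 1, as the case
    -- $d\ge N$ requires.
    refine ⟨1, one_pos, ((N : ℝ) + 1) ^ 10, fun d => 3606 / Real.log d,
      tendsto_const_div_log_natCast _, ?_⟩
    intro d r U μ₀ μ₁ μ₂ p σ hr hU hinc hp hσ hrR hμM _ hpd
    have hd := hpos hr hU
    rcases lt_or_ge d N with hdN | hdN
    · exact hsmall hd hdN measureReal_nonneg
    obtain ⟨h1, h2, h3, h4⟩ := hN d hdN
    have hd' : (0 : ℝ) < d := by exact_mod_cast hd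
    set μ := max μ₀ (max μ₁ μ₂) with hμ
    have hμ1 : 1 ≤ μ := (hinc.one_le hU hr).trans (by simp [hμ])
    have hμM' : μ ≤ M' := hμM.trans (le_max_left _ _)
    have hrγ : (r : ℝ) ^ 2 * (μ / d) ≤ 1 := by
      rw [← mul_div_assoc, div_le_one hd']
      refine le_trans ?_ h3
      gcongr
    refine hlarge hd (natCast_le_of_sq_mul_div_le hμ1 hd hrγ) h4 ?_
    have := hinc.le_samplingLaw_riskLowerBounds hU hr hp hσ hμ h1
      ((div_le_div_of_nonneg_right hμM' hd'.le).trans h2) hrγ (q := 1 / M' ^ 2) ?_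
    · rwa [mul_div_right_comm] at this
    · refine le_trans ?_ hpd
      rw [one_mul, mul_div_assoc, ← mul_assoc]
      refine mul_le_of_le_one_left (by positivity) ?_
      rw [one_div, inv_mul_eq_div, div_le_one (by positivity)]
      gcongr
  · obtain ⟨N, hN⟩ := eventually_atTop.1
      (hlog.and (eventually_mul_exp_neg_le (by norm_num : (0 : ℝ) < 1 / 432)))
    refine ⟨1, 1, one_pos, one_pos, ((N : ℝ) + 1) ^ 10, fun d => 3606 / Real.log d,
      tendsto_const_div_log_natCast _, ?_⟩
    intro d r U μ₀ μ₁ μ₂ μ p σ hr hU hinc hμ hp hσ _ hpd hrd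
    have hd := hpos hr hU
    rcases lt_or_ge d N with hdN | hdN
    · exact hsmall hd hdN measureReal_nonneg
    obtain ⟨h1, h4⟩ := hN d hdN
    have hd' : (0 : ℝ) < d := by exact_mod_cast hd
    have hr1 : (1 : ℝ) ≤ r := by exact_mod_cast hr
    have hlog0 := one_pos.trans_le h1
    have hμ1 : 1 ≤ μ := (hinc.one_le hU hr).trans (by simp [hμ])
    have hμ0 : 0 < μ := one_pos.trans_le hμ1
    -- Squared, the rank condition reads $r^2\mu/d\le1/\log d$; this yields both the
    -- near-orthogonality and, since $r\ge1$, the bound $\mu/d\le1/\log d$.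
    rw [one_mul, Real.le_sqrt' (by positivity)] at hrd
    have hrγ' : (r : ℝ) ^ 2 * (μ / d) ≤ 1 / Real.log d := by
      rw [le_div_iff₀ (by positivity)] at hrd
      rw [← mul_div_assoc, div_le_div_iff₀ hd' hlog0]
      linarith
    have hγ : μ / d ≤ 1 / Real.log d :=
      (le_mul_of_one_le_left (by positivity) (one_le_pow₀ hr1)).trans hrγ'
    have hrγ : (r : ℝ) ^ 2 * (μ / d) ≤ 1 :=
      hrγ'.trans (by rw [div_le_one hlog0]; exact h1)
    refine hlarge hd (natCast_le_of_sq_mul_div_le hμ1 hd hrγ) h4 ?_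
    have := hinc.le_samplingLaw_riskLowerBounds hU hr hp hσ hμ h1 hγ hrγ (q := 1) ?_
    · rwa [mul_div_right_comm] at this
    · refine le_trans ?_ hpd
      gcongr
      exact le_mul_of_one_le_right (by positivity) hr1
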